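/- **Setting.** Let $f:\mathbb R^d\to\mathbb R$ be differentiable and bounded below with $\|\nabla f(x)-\nabla f(y)\|\le L\|x-y\|$ for all $x,y$, where $L>0$. Let $\mathcal D$ be a probability distribution and $\nabla f(x;\xi)$ (jointly measurable) stochastic gradients with $\mathbb E_{\xi\sim\mathcal D}[\nabla f(x;\xi)]=\nabla f(x)$ and $\mathbb E_{\xi\sim\mathcal D}\|\nabla f(x;\xi)-\nabla f(x)\|^2\le\sigma^2$ for all $x$, where $\sigma\ge 0$. Let $w^0\in\mathbb R^d$, $\Delta:=f(w^0)-\inf f$, $\varepsilon>0$, and let $b\ge1$ be an integer. **Computation trees.** A computation tree has a root $w^0$ and is built iteratively. Each iteration chooses already computed nodes $w_{\rm base}$, $w_{\rm grad}$, a step size $\gamma$ and a sample $\zeta$ (samples may be reused), and adds the node $w_{\rm new}=w_{\rm base}-\gamma\nabla f(w_{\rm grad};\zeta)$ with an edge from $w_{\rm base}$. A main branch is an infinite path $x^0=w^0,x^1,x^2,\dots$ in the tree; its auxiliary sequence $(\gamma_k,z^k,\xi^k)$, with $\gamma_k>0$ and $\xi^k\sim\mathcal D$, is given by the iterations $x^{k+1}=x^k-\gamma_k\nabla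 f(z^k;\xi^k)$. For nodes $y,z$, $\mathrm{dist}(y,z)$ is the larger of the numbers of edges from their closest common ancestor to $y$ and to $z$; $\mathrm{dist}(y,\{x^k\})=\min_k\mathrm{dist}(y,x^k)$; and $\mathrm{repr}(y)$ is the multiset of the pairs $(w_{\rm grad},\zeta)$ along the path from the root to $y$. **Method (asynchronous Decaying Local SGD with $n$ workers).** In round $r=0,1,2,\dots$, worker $i\in\{1,\dots,n\}$ starts from $z^r_{i,0}=w^r$ and runs $M^r_i$ local steps $$z^r_{i,j+1}=z^r_{i,j}-\eta_j\nabla f(z^r_{i,j};\zeta^r_{i,j}),\qquad \eta_j=\sqrt{\frac{b-1}{(j+1)(\log(b-1)+1)}}\;\eta_g$$ (with $\eta_j=0$ if $b=1$), where $\sum_{i=1}^nM^r_i=b$. Then $w^{r+1}=w^r-\eta_g\sum_{i=1}^n\sum_{j=0}^{M^r_i-1}\nabla f(z^r_{i,j};\zeta^r_{i,j})$. The samples $\zeta^r_{i,j}$ are i.i.d. with law $\mathcal D$. The numbers $M^r_i$ may be random and may depend on the past: for every $r$, the samples of round $r$ are independent of $(M^0,\dots,M^r)$ and the samples of rounds before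 $r$. The step size is $$\eta_g=\min\Big\{\frac1{4bL},\frac{\varepsilon}{8\sigma^2L}\Big\}\qquad\Big(\tfrac{\varepsilon}{8\sigma^2L}=+\infty\text{ if }\sigma=0\Big).$$ In the computation tree of the method every stochastic gradient $\nabla f(z^r_{i,j};\zeta^r_{i,j})$, $j<M^r_i$, is used twice: for the local step that produces $z^r_{i,j+1}$, and for one step of the following sequence. **Theorem.** Let $x^0=w^0$ and, for all $r$, $i$ and $0\le j<M^r_i$, $$x^{k+1}=x^k-\eta_g\nabla f(z^r_{i,j};\zeta^r_{i,j}),\qquad k=rb+M^r_1+\dots+M^r_{i-1}+j .$$ Then $x^{rb}=w^r$ for all $r$, and $\{x^k\}$ is a main branch of the computation tree of the method. With its auxiliary sequence $(\gamma_k,z^k,\xi^k)$, given by $z^k=z^r_{i,j}$ and $\xi^k=\zeta^r_{i,j}$ for the above $k$, it satisfies the following conditions with $R=b-1$: 1. for every $k$, $\xi^k$ is independent of $\{(x^{i+1},z^{i+1},\xi^i)\}_{i=0}^{k-1}$; 2. $\mathrm{repr}(z^k)\subseteq\mathrm{repr}(x^k)$ for every $k$; 3. $\mathrm{dist}(x^k,z^k)\le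 R$ for every $k$; 4. $\gamma_k=\eta_g\le\min\{\frac1{2L},\frac1{4RL},\frac{\varepsilon}{8\sigma^2L}\}$ for every $k$ (a fraction with denominator $0$ is $+\infty$), and every other step size $\gamma$ in the tree satisfies $0\le\gamma\le\sqrt{\frac{R}{(j+1)(\log R+1)}}\,\eta_g$ with $j=\mathrm{dist}(y,\{x^k\})$, where $y$ is the node at which the step is applied (the bound is $0$ if $R=0$). Moreover, each $\|\nabla f(x^k)\|^2$ is integrable, and $$\frac1K\sum_{k=0}^{K-1}\mathbb E\|\nabla f(x^k)\|^2\le\varepsilon\qquad\text{for all integers } K\ge\frac{8bL\Delta}{\varepsilon}+\frac{16\sigma^2L\Delta}{\varepsilon^2}.$$ -/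

import Mathlib

open MeasureTheory ProbabilityTheory

namespace BirchSGD

/-! ### Assumptions on the objective and on the stochastic gradients -/

/-- `f` is differentiable with an `L`-Lipschitz gradient. -/
structure IsSmooth {d : ℕ} (f : EuclideanSpace ℝ (Fin d) → ℝ) (L : ℝ) : Prop where
  differentiable : Differentiable ℝ f
  lipschitz : ∀ x y, ‖gradient f x - gradient f y‖ ≤ L * ‖x - y‖

/-- `G x s` (written `∇f(x; s)` on paper), with `s` drawn from `D`, is an unbiased stochastic
gradient of `f` at `x` whose variance is at most `σ ^ 2`, for every `x`. -/
structure IsStochasticGradient {d : ℕ} {S : Type*} [MeasurableSpace S]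
    (f : EuclideanSpace ℝ (Fin d) → ℝ)
    (G : EuclideanSpace ℝ (Fin d) → S → EuclideanSpace ℝ (Fin d))
    (D : Measure S) (σ : ℝ) : Prop where
  measurable : Measurable (Function.uncurry G)
  integrable : ∀ x, Integrable (G x) D
  unbiased : ∀ x, ∫ s, G x s ∂D = gradient f x
  integrable_sq : ∀ x, Integrable (fun s => ‖G x s - gradient f x‖ ^ 2) D
  variance_le : ∀ x, ∫ s, ‖G x s - gradient f x‖ ^ 2 ∂D ≤ σ ^ 2

/-! ### Computation trees -/

/-- A computation tree. The nodes are the natural numbers: node `0` is the root `w⁰`, and node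
`k + 1` is the point computed in iteration `k`, namely
`w^{k+1} = w_base - γ ∇f(w_grad; ζ)`, where `base k` and `grad k` are the (already computed) nodes
`w_base` and `w_grad`, `step k` is `γ`, and `label k` is the name of the random sample `ζ`
(samples may be reused, so two iterations may carry the same name).
Iteration `k` adds the edge from `base k` to `k + 1`. -/
structure ComputationTree (I : Type*) where
  base : ℕ → ℕ
  grad : ℕ → ℕ
  step : ℕ → ℝ
  label : ℕ → I
  base_le : ∀ k, base k ≤ k
  grad_le : ∀ k, grad k ≤ k

namespace ComputationTree

variable {I : Type*}

/-- The vector sitting at a node, given the starting point, the stochastic gradients and the values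
of the samples. -/
noncomputable def point {E S : Type*} [AddCommGroup E] [Module ℝ E] (T : ComputationTree I)
    (w₀ : E) (G : E → S → E) (s : I → S) : ℕ → E
  | 0 => w₀
  | k + 1 =>
      have := T.base_le k
      have := T.grad_le k
      point T w₀ G s (T.base k) - T.step k • G (point T w₀ G s (T.grad k)) (s (T.label k))

/-- The number of edges between the root and a node. -/
def depth (T : ComputationTree I) : ℕ → ℕ
  | 0 => 0
  | k + 1 =>
      have := T.base_le k
      depth T (T.base k) + 1

/-- The ancestors of a node, including the node itself. -/
def ancestors (T : ComputationTree I) : ℕ → Finset ℕ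
  | 0 => {0}
  | k + 1 =>
      have := T.base_le k
      insert (k + 1) (ancestors T (T.base k))

/-- The depth of the closest (that is, deepest) common ancestor of `y` and `z`. -/
def commonDepth (T : ComputationTree I) (y z : ℕ) : ℕ :=
  (T.ancestors y ∩ T.ancestors z).sup T.depth

/-- The tree distance: the maximal number of edges separating `y` and `z` from their closest common
ancestor. -/
def dist (T : ComputationTree I) (y z : ℕ) : ℕ :=
  max (T.depth y - T.commonDepth y z) (T.depth z - T.commonDepth y z)

/-- The distance from a node to a sequence of nodes, `min_k dist(y, x^k)`. -/
noncomputable def distBranch (T : ComputationTree I) (y : ℕ) (x : ℕ → ℕ) : ℕ :=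
  ⨅ k, T.dist y (x k)

/-- The representation of a node: the multiset of stochastic gradients, each given by the node at
which it is evaluated and the name of its sample, applied to the root to reach the node. -/
def repr (T : ComputationTree I) : ℕ → Multiset (ℕ × I)
  | 0 => 0
  | k + 1 =>
      have := T.base_le k
      (T.grad k, T.label k) ::ₘ repr T (T.base k)

/-- The nodes `x` form a main branch, that is, an infinite path starting at the root, with auxiliary
sequence `(γ, z, ξ)`: iteration `e` below is the one that computes `x (k + 1)` from `x k`. -/
def IsMainBranch (T : ComputationTree I) (x : ℕ → ℕ) (γ : ℕ → ℝ) (z : ℕ → ℕ) (ξ : ℕ → I) : Prop :=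
  x 0 = 0 ∧ ∀ k, ∃ e, x (k + 1) = e + 1 ∧ T.base e = x k ∧
    T.step e = γ k ∧ 0 < γ k ∧ T.grad e = z k ∧ T.label e = ξ k

end ComputationTree

/-- The conditions of the main theorem on a (random) computation tree `T` with samples `ζ`, a main
branch `x`, its auxiliary sequence `(γ, z, ξ)`, a constant `R` and a main step size `γg`. -/
structure MainConditions {Ω I S E : Type*} [MeasurableSpace Ω] [MeasurableSpace S]
    [AddCommGroup E] [Module ℝ E] [MeasurableSpace E]
    (μ : Measure Ω) (D : Measure S) (w₀ : E) (G : E → S → E) (ζ : I → Ω → S)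
    (T : Ω → ComputationTree I) (x : Ω → ℕ → ℕ) (γ : Ω → ℕ → ℝ) (z : Ω → ℕ → ℕ) (ξ : Ω → ℕ → I)
    (L σ ε R γg : ℝ) : Prop where
  /-- `x` is a main branch with auxiliary sequence `(γ, z, ξ)`, and `ξ^k` has law `D`. -/
  branch : ∀ ω, (T ω).IsMainBranch (x ω) (γ ω) (z ω) (ξ ω)
  law : ∀ k, Measurable (fun ω => ζ (ξ ω k) ω) ∧ μ.map (fun ω => ζ (ξ ω k) ω) = D
  /-- Condition 1: `ξ^k` is independent of `(x^{i+1}, z^{i+1}, ξ^i)`, `i < k`. -/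
  indep : ∀ k, IndepFun (fun ω => ζ (ξ ω k) ω)
    (fun ω (i : Fin k) =>
      ((T ω).point w₀ G (fun a => ζ a ω) (x ω (i + 1)),
       (T ω).point w₀ G (fun a => ζ a ω) (z ω (i + 1)),
       ζ (ξ ω i) ω)) μ
  /-- Condition 2: the representation of `z^k` is contained in that of `x^k`. -/
  repr_le : ∀ ω k, (T ω).repr (z ω k) ≤ (T ω).repr (x ω k)
  /-- Condition 3: `z^k` and `x^k` are at tree distance at most `R`. -/
  dist_le : ∀ ω k, ((T ω).dist (x ω k) (z ω k) : ℝ) ≤ R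
  /-- Condition 4: the steps along the main branch are all equal to `γg`, where `γg` is at most
  `1 / (2 L)`, `1 / (4 R L)` and `ε / (8 σ² L)`, and every other step, applied at a node at distance
  `j` from the main branch, is at most `√(R / ((j + 1) (log R + 1))) γg`. -/
  step_eq : ∀ ω k, γ ω k = γg
  step_le : 2 * L * γg ≤ 1 ∧ 4 * R * L * γg ≤ 1 ∧ 8 * σ ^ 2 * L * γg ≤ ε
  other_step_le : ∀ ω e, (∀ k, x ω (k + 1) ≠ e + 1) →
    0 ≤ (T ω).step e ∧
    (T ω).step e ≤
      √(R / ((((T ω).distBranch ((T ω).base e) (x ω) : ℕ) + 1) * (Real.log R + 1))) * γg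

/-! ### Decaying Local SGD, asynchronous version -/

/-- The numbers `M_i` of local steps: in round `r`, worker `i` runs `steps r i` local steps, and
every round gathers exactly `b ≥ 1` stochastic gradients. -/
structure Schedule (n b : ℕ) where
  steps : ℕ → Fin n → ℕ
  pos : 0 < b
  sum_eq : ∀ r, ∑ i, steps r i = b

/-- The step size of the local step with index `j`:
`√((b - 1) / ((j + 1) (log (b - 1) + 1))) η`. For `b = 1` it is `0`. -/
noncomputable def localStep (b : ℕ) (η : ℝ) (j : ℕ) : ℝ :=
  √(((b : ℝ) - 1) / (((j : ℝ) + 1) * (Real.log ((b : ℝ) - 1) + 1))) * η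

/-- The global step size `min {1 / (4 b L), ε / (8 σ² L)}`, where the second entry is `+∞` if
`σ = 0`. -/
noncomputable def globalStep (b : ℕ) (L σ ε : ℝ) : ℝ :=
  if σ = 0 then 1 / (4 * b * L) else min (1 / (4 * b * L)) (ε / (8 * σ ^ 2 * L))

section Algorithm

variable {n b : ℕ} {E S : Type*} [AddCommGroup E] [Module ℝ E]

/-- The local iterates of one worker in one round: `z_0 = w` and
`z_{j+1} = z_j - η_j ∇f(z_j; ζ_j)`. -/
noncomputable def localIterate (b : ℕ) (η : ℝ) (G : E → S → E) (w : E) (ζ : ℕ → S) : ℕ → E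
  | 0 => w
  | j + 1 => localIterate b η G w ζ j - localStep b η j • G (localIterate b η G w ζ j) (ζ j)

/-- The global models: `w^{r+1} = w^r - η ∑_i ∑_{j < M_i} ∇f(z^r_{i,j}; ζ^r_{i,j})`. The sample
`ζ^r_{i,j}` is `ζ (r, i, j)`. -/
noncomputable def globalModel (M : Schedule n b) (η : ℝ) (w₀ : E) (G : E → S → E)
    (ζ : ℕ × Fin n × ℕ → S) : ℕ → E
  | 0 => w₀
  | r + 1 => globalModel M η w₀ G ζ r - η • ∑ i, ∑ j ∈ Finset.range (M.steps r i),
      G (localIterate b η G (globalModel M η w₀ G ζ r) (fun l => ζ (r, i, l)) j) (ζ (r, i, j))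

/-- The local point `z^r_{i,j}` of the algorithm. -/
noncomputable def localPoint (M : Schedule n b) (η : ℝ) (w₀ : E) (G : E → S → E)
    (ζ : ℕ × Fin n × ℕ → S) (r : ℕ) (i : Fin n) (j : ℕ) : E :=
  localIterate b η G (globalModel M η w₀ G ζ r) (fun l => ζ (r, i, l)) j

/-- The name `(r, i, j)` of the `k`-th stochastic gradient when the gradients are listed round by
round, inside a round worker by worker, and for each worker by local index. -/
def Schedule.sample (M : Schedule n b) (k : ℕ) : ℕ × Fin n × ℕ :=
  let p := finSigmaFinEquiv.symm
    (Fin.cast (M.sum_eq (k / b)).symm ⟨k % b, Nat.mod_lt k M.pos⟩)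
  (k / b, p.1, (p.2 : ℕ))

/-- The explicit sequence `x^0 = w^0`, `x^{k+1} = x^k - η ∇f(z^r_{i,j}; ζ^r_{i,j})`, where the
gradients are taken in the above order. -/
noncomputable def mainSequence (M : Schedule n b) (η : ℝ) (w₀ : E) (G : E → S → E)
    (ζ : ℕ × Fin n × ℕ → S) : ℕ → E
  | 0 => w₀
  | k + 1 => mainSequence M η w₀ G ζ k -
      η • G (localPoint M η w₀ G ζ (M.sample k).1 (M.sample k).2.1 (M.sample k).2.2)
        (ζ (M.sample k))

end Algorithm

section Tree

variable {n b : ℕ}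

/-- The node at which the `k`-th stochastic gradient is evaluated. Node `2 k` of the tree is `x^k`,
and node `2 k + 1` is the local point `z^r_{i,j+1}` computed with the `k`-th stochastic gradient
`(r, i, j)`. Hence `z^r_{i,0} = w^r = x^{r b}` is node `2 (r b)`, and for `j ≥ 1` the point
`z^r_{i,j}` was computed with the gradient number `k - 1`. -/
def Schedule.gradNode (M : Schedule n b) (k : ℕ) : ℕ :=
  if (M.sample k).2.2 = 0 then 2 * ((M.sample k).1 * b) else 2 * k - 1

/-- The computation tree of the method. The `k`-th stochastic gradient is used twice: iteration
`2 k` applies it at the local point where it was evaluated, with the local step size, and iteration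
`2 k + 1` applies it at `x^k`, with the global step size. -/
noncomputable def decayingTree (M : Schedule n b) (η : ℝ) : ComputationTree (ℕ × Fin n × ℕ) where
  base e := if e % 2 = 0 then M.gradNode (e / 2) else 2 * (e / 2)
  grad e := M.gradNode (e / 2)
  step e := if e % 2 = 0 then localStep b η (M.sample (e / 2)).2.2 else η
  label e := M.sample (e / 2)
  base_le e := by
    have h : (M.sample (e / 2)).1 * b ≤ e / 2 := Nat.div_mul_le_self _ _
    unfold Schedule.gradNode
    split_ifs <;> omega
  grad_le e := by
    have h : (M.sample (e / 2)).1 * b ≤ e / 2 := Nat.div_mul_le_self _ _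
    unfold Schedule.gradNode
    split_ifs <;> omega

end Tree

end BirchSGD

open BirchSGD

/-! The method is SGD along the main branch, `x^{k+1} = x^k - η G(z^k; ξ^k)`, with the gradient
evaluated at a displaced point `z^k`. Put `a = ∇f(x^k)` and `c = ∇f(z^k)`. Smoothness and `2⟨a, c⟩ =
‖a‖² + ‖c‖² - ‖a - c‖²` show that, in expectation, a step decreases `f` by at least `η/2 ‖a‖² + η(1
- Lη)/2 ‖c‖²`, up to the error terms `η/2 ‖a - c‖²` and `Lη²σ²/2` (`integral_descent`). Since `‖a -
c‖ ≤ L‖x^k - z^k‖`, what remains is to control the drift `x^k - z^k`.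

Both points start from the same global model and use only gradients of the current round, so the
drift is a linear combination of those gradients, with coefficients `-η` or local step minus `η`
(`main_sub_local`). The decay of the local steps turns the sum of their squares into a harmonic sum,
cancelled by the factor `log (b - 1) + 1`; hence the squared coefficients add up to at most `2(b -
1)η²` (`sum_driftCoeff_sq_le`). The gradient part of the drift is then bounded by Cauchy-Schwarz,
and the noise part by orthogonality of martingale differences (`integral_sq_sum_noise_le`). After
summation over `k` each gradient is counted at most `b - 1` times, and `(b - 1)Lη ≤ 1/4` lets the
term in `‖c‖²` of the descent absorb the result (`sum_sq_le_of_descent`).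

The numbers of local steps are random, so the name of the `k`-th sample is random too. The
filtration therefore contains all step numbers up to the current round: the drift coefficients are
known when the round begins, and the used sample is still fresh, as one sees by splitting over the
countably many histories of step numbers (`measure_usedSample_inter_pastData`).

The tree conditions are combinatorial: `x^k` and `z^k` share the node of the current global model as
an ancestor, and every gradient used in a local step is also applied on the main branch. -/

namespace BirchSGD

/-! ### Smooth functions -/

section Smooth

variable {d : ℕ} {f : EuclideanSpace ℝ (Fin d) → ℝ} {L : ℝ}

theorem IsSmooth.continuous_gradient (hf : IsSmooth f L) : Continuous (gradient f) :=
  (LipschitzWith.of_dist_le_mul (K := L.toNNReal) fun x y => by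
    rw [dist_eq_norm, dist_eq_norm]
    exact (hf.lipschitz x y).trans
      (mul_le_mul_of_nonneg_right (Real.le_coe_toNNReal L) (norm_nonneg _))).continuous

/-- Along the segment, `f` minus the claimed quadratic bound has nonpositive derivative by the
Lipschitz estimate, so comparing the endpoints suffices and no integral is needed. -/
theorem IsSmooth.le_add_inner_add_sq (hf : IsSmooth f L) (x y : EuclideanSpace ℝ (Fin d)) :
    f y ≤ f x + inner ℝ (gradient f x) (y - x) + L / 2 * ‖y - x‖ ^ 2 := by
  set v := y - x with hv
  set g : ℝ → ℝ := fun t =>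
    f (x + t • v) - t * inner ℝ (gradient f x) v - L / 2 * ‖v‖ ^ 2 * t ^ 2 with hg
  have hderiv : ∀ t, HasDerivAt g (inner ℝ (gradient f (x + t • v)) v -
      inner ℝ (gradient f x) v - L * ‖v‖ ^ 2 * t) t := by
    intro t
    have h1 : HasDerivAt (fun t : ℝ => x + t • v) v t := by
      simpa using ((hasDerivAt_id t).smul_const v).const_add x
    have h2 := ((hf.differentiable (x + t • v)).hasGradientAt.hasFDerivAt).comp_hasDerivAt t h1
    have h3 := (h2.sub ((hasDerivAt_id t).mul_const (inner ℝ (gradient f x) v))).sub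
      ((hasDerivAt_pow 2 t).const_mul (L / 2 * ‖v‖ ^ 2))
    refine h3.congr_deriv ?_
    simp
    ring
  have hanti : AntitoneOn g (Set.Icc 0 1) := by
    apply antitoneOn_of_deriv_nonpos (convex_Icc 0 1)
    · exact fun t _ => (hderiv t).continuousAt.continuousWithinAt
    · exact fun t _ => (hderiv t).differentiableAt.differentiableWithinAt
    · intro t ht
      rw [interior_Icc] at ht
      rw [(hderiv t).deriv, ← inner_sub_left]
      have h1 := real_inner_le_norm (gradient f (x + t • v) - gradient f x) v
      have h2 := hf.lipschitz (x + t • v) x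
      rw [add_sub_cancel_left, norm_smul, Real.norm_of_nonneg ht.1.le] at h2
      have h3 := mul_le_mul_of_nonneg_right h2 (norm_nonneg v)
      nlinarith
  have h01 := hanti (Set.left_mem_Icc.2 zero_le_one) (Set.right_mem_Icc.2 zero_le_one) zero_le_one
  simp only [hg, hv, one_smul, zero_smul, add_zero, add_sub_cancel] at h01
  linarith

end Smooth

/-! ### Step sizes -/

theorem globalStep_pos {b : ℕ} {L σ ε : ℝ} (hb : 0 < b) (hL : 0 < L) (hσ : 0 ≤ σ) (hε : 0 < ε) :
    0 < globalStep b L σ ε := by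
  have hb' : (0 : ℝ) < b := Nat.cast_pos.2 hb
  unfold globalStep
  split_ifs with h
  · positivity
  · have : 0 < σ := lt_of_le_of_ne hσ (Ne.symm h)
    exact lt_min (by positivity) (by positivity)

theorem globalStep_le {b : ℕ} {L σ ε : ℝ} (hb : 0 < b) (hL : 0 < L) :
    4 * b * L * globalStep b L σ ε ≤ 1 := by
  have hb' : (0 : ℝ) < b := Nat.cast_pos.2 hb
  have h : globalStep b L σ ε ≤ 1 / (4 * b * L) := by
    unfold globalStep
    split_ifs
    · exact le_rfl
    · exact min_le_left _ _
  rwa [le_div_iff₀' (by positivity)] at h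

theorem sq_mul_globalStep_le {b : ℕ} {L σ ε : ℝ} (hL : 0 < L) (hσ : 0 ≤ σ) (hε : 0 < ε) :
    8 * σ ^ 2 * L * globalStep b L σ ε ≤ ε := by
  unfold globalStep
  split_ifs with h
  · simp [h, hε.le]
  · have : 0 < σ := lt_of_le_of_ne hσ (Ne.symm h)
    rw [← le_div_iff₀' (by positivity)]
    exact min_le_right _ _

theorem globalStep_eq_or {b : ℕ} {L σ ε : ℝ} (hb : 0 < b) (hL : 0 < L) (hσ : 0 ≤ σ) :
    4 * b * L * globalStep b L σ ε = 1 ∨ 8 * σ ^ 2 * L * globalStep b L σ ε = ε := by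
  have hb' : (0 : ℝ) < b := Nat.cast_pos.2 hb
  unfold globalStep
  split_ifs with h
  · left; field_simp
  · have : 0 < σ := lt_of_le_of_ne hσ (Ne.symm h)
    rcases min_choice (1 / (4 * b * L)) (ε / (8 * σ ^ 2 * L)) with h | h
    · left; rw [h]; field_simp
    · right; rw [h]; field_simp

theorem localStep_nonneg {b : ℕ} {η : ℝ} (hη : 0 ≤ η) (j : ℕ) : 0 ≤ localStep b η j :=
  mul_nonneg (Real.sqrt_nonneg _) hη

theorem log_sub_one_nonneg {b : ℕ} (hb : 0 < b) : 0 ≤ Real.log ((b : ℝ) - 1) := by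
  -- As a natural number, `b - 1` is either `0`, where `Real.log 0 = 0`, or at least `1`.
  have h : (b : ℝ) - 1 = ((b - 1 : ℕ) : ℝ) := by rw [Nat.cast_sub hb, Nat.cast_one]
  rw [h]
  exact Real.log_natCast_nonneg _

theorem localStep_sq {b : ℕ} (hb : 0 < b) (η : ℝ) (j : ℕ) :
    localStep b η j ^ 2 = ((b : ℝ) - 1) / (Real.log ((b : ℝ) - 1) + 1) * η ^ 2 *
      ((j : ℝ) + 1)⁻¹ := by
  have h1 : (0 : ℝ) ≤ (b : ℝ) - 1 := sub_nonneg.2 (Nat.one_le_cast.2 hb)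
  have h2 := log_sub_one_nonneg hb
  rw [localStep, mul_pow, Real.sq_sqrt (by positivity)]
  field_simp

/-- The squares are proportional to `1 / (l + 1)`, and a harmonic sum of at most `b - 1` terms is
bounded by the normalisation `log (b - 1) + 1`. Thus decaying local steps have the same square
budget as `b - 1` steps of size `η`. -/
theorem sum_localStep_sq_le {b : ℕ} (hb : 0 < b) (η : ℝ) {j : ℕ} (hj : j ≤ b - 1) :
    ∑ l ∈ Finset.range j, localStep b η l ^ 2 ≤ ((b : ℝ) - 1) * η ^ 2 := by
  have h1 : (0 : ℝ) ≤ (b : ℝ) - 1 := sub_nonneg.2 (Nat.one_le_cast.2 hb)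
  have h2 := log_sub_one_nonneg hb
  simp_rw [localStep_sq hb]
  rw [← Finset.mul_sum]
  rcases Nat.eq_zero_or_pos j with rfl | hj0
  · simp only [Finset.range_zero, Finset.sum_empty, mul_zero]
    positivity
  have h3 : ∑ l ∈ Finset.range j, ((l : ℝ) + 1)⁻¹ ≤ Real.log ((b : ℝ) - 1) + 1 := by
    have h4 := harmonic_le_one_add_log j
    rw [harmonic] at h4
    push_cast at h4
    have h5 : Real.log j ≤ Real.log ((b : ℝ) - 1) := by
      apply Real.log_le_log (Nat.cast_pos.2 hj0)
      rw [← Nat.cast_one, ← Nat.cast_sub hb]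
      exact Nat.cast_le.2 hj
    linarith
  calc ((b : ℝ) - 1) / (Real.log ((b : ℝ) - 1) + 1) * η ^ 2 *
        ∑ l ∈ Finset.range j, ((l : ℝ) + 1)⁻¹
      ≤ ((b : ℝ) - 1) / (Real.log ((b : ℝ) - 1) + 1) * η ^ 2 *
        (Real.log ((b : ℝ) - 1) + 1) := by gcongr
    _ = ((b : ℝ) - 1) * η ^ 2 := by field_simp

/-- If `z` is obtained from the first model of the round by the last `j` local steps before the
gradient number `k`, this is the coefficient of the gradient number `p` of the round in the
difference of the `k`-th point of the main sequence and `z`. -/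
noncomputable def driftCoeff (b : ℕ) (η : ℝ) (k j p : ℕ) : ℝ :=
  (if k - j ≤ p then localStep b η (p - (k - j)) else 0) - η

theorem sum_driftCoeff_sq_le {b : ℕ} (hb : 0 < b) {η : ℝ} (hη : 0 ≤ η) {s k j : ℕ}
    (hj : s + j ≤ k) (hk : k < s + b) :
    ∑ p ∈ Finset.Ico s k, driftCoeff b η k j p ^ 2 ≤ 2 * ((b : ℝ) - 1) * η ^ 2 := by
  have h1 : ∑ p ∈ Finset.Ico s k, (if k - j ≤ p then localStep b η (p - (k - j)) else 0) ^ 2 ≤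
      ((b : ℝ) - 1) * η ^ 2 := by
    have : ∀ p, (if k - j ≤ p then localStep b η (p - (k - j)) else 0) ^ 2 =
        if k - j ≤ p then localStep b η (p - (k - j)) ^ 2 else 0 := by
      intro p
      split_ifs <;> simp
    simp_rw [this]
    rw [← Finset.sum_filter]
    have hfilter : (Finset.Ico s k).filter (fun p => k - j ≤ p) = Finset.Ico (k - j) k := by
      ext p
      simp only [Finset.mem_filter, Finset.mem_Ico]
      omega
    rw [hfilter, Finset.sum_Ico_eq_sum_range]
    simp only [add_tsub_cancel_left]
    exact sum_localStep_sq_le hb η (by omega)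
  have h2 : ∑ p ∈ Finset.Ico s k, η ^ 2 ≤ ((b : ℝ) - 1) * η ^ 2 := by
    rw [Finset.sum_const, Nat.card_Ico, nsmul_eq_mul, ← Nat.cast_one, ← Nat.cast_sub hb]
    exact mul_le_mul_of_nonneg_right (Nat.cast_le.2 (by omega)) (sq_nonneg η)
  -- Local and global coefficients are both nonnegative and enter with opposite signs, so the cross
  -- term of the square can be dropped; this saves a factor 2.
  have h3 : ∀ p, driftCoeff b η k j p ^ 2 ≤
      (if k - j ≤ p then localStep b η (p - (k - j)) else 0) ^ 2 + η ^ 2 := by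
    intro p
    have : 0 ≤ if k - j ≤ p then localStep b η (p - (k - j)) else 0 := by
      split_ifs
      · exact localStep_nonneg hη _
      · exact le_rfl
    unfold driftCoeff
    nlinarith [mul_nonneg this hη]
  refine (Finset.sum_le_sum fun p _ => h3 p).trans ?_
  rw [Finset.sum_add_distrib]
  linarith

/-! ### Summation -/

/-- After exchanging the sums, index `p` is met only by `k` with `p < k < p + b`, which leaves `b -
1` values. -/
theorem sum_sum_Ico_round_le {b : ℕ} (hb : 0 < b) (C : ℕ → ℝ) (hC : ∀ k, 0 ≤ C k) (K : ℕ) :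
    ∑ k ∈ Finset.range K, ∑ p ∈ Finset.Ico (k / b * b) k, C p ≤
      ((b : ℝ) - 1) * ∑ p ∈ Finset.range K, C p := by
  have h1 : ∀ k ∈ Finset.range K, ∑ p ∈ Finset.Ico (k / b * b) k, C p ≤
      ∑ p ∈ Finset.range K, if k ∈ Finset.Ioo p (p + b) then C p else 0 := by
    intro k hk
    rw [← Finset.sum_filter]
    refine Finset.sum_le_sum_of_subset_of_nonneg (fun p hp => ?_) (fun p _ _ => hC p)
    have h2 := Nat.div_add_mod' k b
    have h3 := Nat.mod_lt k hb
    simp only [Finset.mem_Ico, Finset.mem_range, Finset.mem_filter, Finset.mem_Ioo] at *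
    omega
  refine (Finset.sum_le_sum h1).trans ?_
  rw [Finset.sum_comm, Finset.mul_sum]
  refine Finset.sum_le_sum fun p _ => ?_
  rw [← Finset.sum_filter, Finset.sum_const, nsmul_eq_mul, ← Nat.cast_one, ← Nat.cast_sub hb]
  refine mul_le_mul_of_nonneg_right (Nat.cast_le.2 ?_) (hC p)
  calc _ ≤ (Finset.Ioo p (p + b)).card :=
        Finset.card_le_card fun k hk => (Finset.mem_filter.1 hk).2
    _ = b - 1 := by rw [Nat.card_Ioo]; omega

/-- Here `α` and `β` measure how close the step size is to its two upper limits, and one limit is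
attained. The crude bound `u ≤ T / 2` improves as the other parameter grows, which pays for the
error terms; the value `9/16` is `1/2 + 1/16` from the case `β = 1`. -/
theorem rate_bound {u α β T : ℝ} (hα : 0 ≤ α) (hα1 : α ≤ 1) (hβ : 0 ≤ β) (hβ1 : β ≤ 1)
    (hu : 0 ≤ u) (hT : 0 ≤ T) (h : 2 * u * (α + β) ≤ T) (hor : α = 1 ∨ β = 1) :
    u + T * β / 16 + 7 / 80 * (α * β * T) ≤ 9 / 16 * T := by
  have aux : ∀ τ : ℝ, 0 ≤ τ → τ ≤ 1 → 2 * u * (1 + τ) ≤ T → u ≤ (1 / 2 - τ / 4) * T := by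
    intro τ h0 h1 h2
    -- `1 - τ / 2` replaces the reciprocal of `1 + τ`: their product is at least `1` on `[0, 1]`.
    have h3 : u * 1 ≤ u * ((1 + τ) * (1 - τ / 2)) :=
      mul_le_mul_of_nonneg_left (by nlinarith) hu
    have h4 := mul_le_mul_of_nonneg_right h2 (show 0 ≤ (1 - τ / 2) / 2 by linarith)
    linarith
  rcases hor with rfl | rfl
  · have h1 := aux β hβ hβ1 h
    linarith [mul_nonneg hβ hT]
  · have h1 := aux α hα hα1 (by rwa [add_comm 1 α])
    linarith [mul_nonneg hα hT]

/-- The arithmetic behind the rate: `V`, `C` and `Q` are the sums of the squared gradient norms along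
the main sequence, along the local points, and of the squared gradient differences. -/
theorem sum_sq_le_of_descent {b : ℕ} {L σ ε η Δ V C Q K : ℝ} (hb : 0 < b) (hL : 0 < L)
    (hσ : 0 ≤ σ) (hε : 0 < ε) (hη : η = globalStep b L σ ε) (hC : 0 ≤ C)
    (hK : 0 ≤ K) (hΔ : 0 ≤ Δ)
    (hrate : 8 * b * L * Δ / ε + 16 * σ ^ 2 * L * Δ / ε ^ 2 ≤ K)
    (hdescent : η * (V / 2 + (1 - L * η) / 2 * C - Q / 2) ≤ Δ + K * (L * η ^ 2 / 2 * σ ^ 2))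
    (hdrift : Q ≤ 4 * ((b : ℝ) - 1) * η ^ 2 * L ^ 2 * (((b : ℝ) - 1) * C + K * σ ^ 2))
    (hVC : V ≤ 2 * C + 2 * Q) : V ≤ ε * K := by
  have hη0 : 0 < η := hη ▸ globalStep_pos hb hL hσ hε
  have hb1 : (1 : ℝ) ≤ b := Nat.one_le_cast.2 hb
  have hα1 : 4 * b * L * η ≤ 1 := hη ▸ globalStep_le hb hL
  have hβ1 : 8 * σ ^ 2 * L * η ≤ ε := hη ▸ sq_mul_globalStep_le hL hσ hε
  have hor : 4 * b * L * η = 1 ∨ 8 * σ ^ 2 * L * η = ε := hη ▸ globalStep_eq_or hb hL hσ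
  set α := 4 * b * L * η with hα
  obtain ⟨β, hβ⟩ : ∃ β, 8 * σ ^ 2 * L * η = ε * β := ⟨8 * σ ^ 2 * L * η / ε, by field_simp⟩
  obtain ⟨u, hu⟩ : ∃ u, Δ = η * u := ⟨Δ / η, by field_simp⟩
  have hα0 : 0 < α := by positivity
  have hβ0 : 0 ≤ β := by
    have : 0 ≤ ε * β := hβ ▸ by positivity
    exact nonneg_of_mul_nonneg_right this hε
  have hβ1' : β ≤ 1 := by
    rw [hβ] at hβ1
    exact le_of_mul_le_mul_left (by linarith) hε
  have hu0 : 0 ≤ u := by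
    rw [hu] at hΔ
    exact nonneg_of_mul_nonneg_right hΔ hη0
  have hT : 0 ≤ ε * K := by positivity
  have hrate' : 2 * u * (α + β) ≤ ε * K := by
    have h1 : 8 * b * L * Δ / ε + 16 * σ ^ 2 * L * Δ / ε ^ 2 = 2 * u * (α + β) / ε := by
      have h2 : 16 * σ ^ 2 * L * Δ = 2 * u * (ε * β) := by rw [hu, ← hβ]; ring
      rw [h2, hu, hα]
      field_simp
      ring
    rw [h1, div_le_iff₀ hε] at hrate
    linarith
  have hLη : L * η ≤ 1 / 4 := by
    have : L * η ≤ b * (L * η) := le_mul_of_one_le_left (by positivity) hb1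
    rw [hα] at hα1
    linarith
  have hdescent' : V / 2 + 3 / 8 * C - Q / 2 ≤ u + ε * K * β / 16 := by
    have h1 : η * (V / 2 + (1 - L * η) / 2 * C - Q / 2) ≤ η * (u + ε * K * β / 16) := by
      refine hdescent.trans_eq ?_
      have : ε * K * β = K * (ε * β) := by ring
      rw [this, ← hβ, hu]
      ring
    have h2 := le_of_mul_le_mul_left h1 hη0
    have h3 := mul_le_mul_of_nonneg_right hLη hC
    linarith
  have hdrift' : Q ≤ C / 4 + α * β * (ε * K) / 8 := by
    refine hdrift.trans ?_
    have hR : ((b : ℝ) - 1) * (L * η) ≤ α / 4 := by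
      have := mul_pos hL hη0
      rw [hα]
      linarith
    have hR0 : 0 ≤ ((b : ℝ) - 1) * (L * η) := by
      have := sub_nonneg.2 hb1
      positivity
    have hR2 : (((b : ℝ) - 1) * (L * η)) ^ 2 ≤ 1 / 16 :=
      (pow_le_pow_left₀ hR0 (hR.trans (by linarith) : _ ≤ (1 / 4 : ℝ)) 2).trans_eq (by norm_num)
    have h3 : 4 * ((b : ℝ) - 1) * η ^ 2 * L ^ 2 * (((b : ℝ) - 1) * C + K * σ ^ 2) =
        4 * (((b : ℝ) - 1) * (L * η)) ^ 2 * C +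
          (((b : ℝ) - 1) * (L * η)) * (K * (8 * σ ^ 2 * L * η) / 2) := by ring
    rw [h3, hβ]
    have h4 := mul_le_mul_of_nonneg_right hR2 hC
    have h5 := mul_le_mul_of_nonneg_right hR (show 0 ≤ K * (ε * β) / 2 by positivity)
    linarith
  -- Add `hdescent'`, `7/10` of `hdrift'` and `1/10` of `hVC`: these weights eliminate both `C` and
  -- `Q`. With the constant `9/16` below, this yields `V ≤ 15/16 ε K`.
  have hmain : 3 / 5 * V ≤ u + ε * K * β / 16 + 7 / 80 * (α * β * (ε * K)) := by linarith
  have hγ := rate_bound hα0.le hα1 hβ0 hβ1' hu0 hT hrate' (hor.imp_right fun h =>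
    mul_left_cancel₀ hε.ne' (by rw [← hβ, h, mul_one]))
  linarith

/-! ### Enumeration of the samples -/

theorem finSigmaFinEquiv_val_eq_sum_filter {n : ℕ} {m : Fin n → ℕ} (i : Fin n) (j : Fin (m i)) :
    (finSigmaFinEquiv ⟨i, j⟩ : ℕ) = ∑ l ∈ Finset.univ.filter (· < i), m l + j := by
  rw [finSigmaFinEquiv_apply]
  congr 1
  refine Finset.sum_bij (fun l _ => Fin.castLE i.2.le l) ?_ ?_ ?_ ?_
  · intro l _
    exact Finset.mem_filter.2 ⟨Finset.mem_univ _, l.2⟩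
  · intro l _ l' _ h
    simpa [Fin.ext_iff] using h
  · intro l hl
    simp only [Finset.mem_filter, Finset.mem_univ, true_and, Fin.lt_def] at hl
    exact ⟨⟨l, hl⟩, Finset.mem_univ _, by simp⟩
  · intros; rfl

namespace Schedule

variable {n b : ℕ} (M : Schedule n b)

theorem sample_eq_of_div_mod {k r v : ℕ} (hv : v < b) (hr : k / b = r) (hm : k % b = v) :
    M.sample k = (r, (finSigmaFinEquiv.symm (Fin.cast (M.sum_eq r).symm ⟨v, hv⟩)).1,
      ((finSigmaFinEquiv.symm (Fin.cast (M.sum_eq r).symm ⟨v, hv⟩)).2 : ℕ)) := by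
  subst hr hm
  rfl

@[simp]
theorem sample_fst (k : ℕ) : (M.sample k).1 = k / b := rfl

theorem sample_lt (k : ℕ) : (M.sample k).2.2 < M.steps (k / b) (M.sample k).2.1 :=
  (finSigmaFinEquiv.symm
    (Fin.cast (M.sum_eq (k / b)).symm ⟨k % b, Nat.mod_lt k M.pos⟩)).2.2

theorem mod_eq_sample (k : ℕ) :
    k % b = ∑ l ∈ Finset.univ.filter (· < (M.sample k).2.1), M.steps (k / b) l +
      (M.sample k).2.2 := by
  have h := finSigmaFinEquiv_val_eq_sum_filter
    (finSigmaFinEquiv.symm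
      (Fin.cast (M.sum_eq (k / b)).symm ⟨k % b, Nat.mod_lt k M.pos⟩)).1
    (finSigmaFinEquiv.symm
      (Fin.cast (M.sum_eq (k / b)).symm ⟨k % b, Nat.mod_lt k M.pos⟩)).2
  rw [Sigma.eta, Equiv.apply_symm_apply] at h
  exact h

theorem offset_add_lt {r : ℕ} {i : Fin n} {j : ℕ} (hj : j < M.steps r i) :
    ∑ l ∈ Finset.univ.filter (· < i), M.steps r l + j < b := by
  have h := (finSigmaFinEquiv (⟨i, ⟨j, hj⟩⟩ : (i : Fin n) × Fin (M.steps r i))).2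
  rw [finSigmaFinEquiv_val_eq_sum_filter, M.sum_eq] at h
  exact h

theorem sample_eq {r : ℕ} {i : Fin n} {j : ℕ} (hj : j < M.steps r i) :
    M.sample (r * b + ∑ l ∈ Finset.univ.filter (· < i), M.steps r l + j) = (r, i, j) := by
  have hv := M.offset_add_lt hj
  rw [add_assoc]
  rw [M.sample_eq_of_div_mod hv (r := r)]
  · have h : Fin.cast (M.sum_eq r).symm ⟨_, hv⟩ =
        finSigmaFinEquiv (⟨i, ⟨j, hj⟩⟩ : (i : Fin n) × Fin (M.steps r i)) := by
      apply Fin.ext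
      rw [finSigmaFinEquiv_val_eq_sum_filter]
      rfl
    rw [h, Equiv.symm_apply_apply]
  · rw [mul_comm, Nat.mul_add_div M.pos, Nat.div_eq_of_lt hv, add_zero]
  · rw [mul_comm, Nat.mul_add_mod, Nat.mod_eq_of_lt hv]

theorem eq_of_sample (k : ℕ) :
    k = k / b * b + ∑ l ∈ Finset.univ.filter (· < (M.sample k).2.1), M.steps (k / b) l +
      (M.sample k).2.2 := by
  rw [add_assoc, ← M.mod_eq_sample, Nat.div_add_mod']

/-- Only the current round of the schedule matters for the name of a sample. This later makes random
names measurable, and constant on each history. -/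
theorem sample_congr {M M' : Schedule n b} {k : ℕ} (h : M.steps (k / b) = M'.steps (k / b)) :
    M.sample k = M'.sample k := by
  have hk := M'.eq_of_sample k
  have hl := M'.sample_lt k
  rw [← h] at hk hl
  have := M.sample_eq hl
  rwa [← hk] at this

theorem sample_injective : Function.Injective M.sample := by
  intro k k' h
  have h1 := M.eq_of_sample k
  have h2 := M.eq_of_sample k'
  have h3 : k / b = k' / b := congrArg Prod.fst h
  rw [h, h3, ← h2] at h1
  exact h1

theorem localIndex_le_mod (k : ℕ) : (M.sample k).2.2 ≤ k % b := by
  rw [M.mod_eq_sample]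
  exact Nat.le_add_left _ _

theorem round_mul_add_localIndex_le (k : ℕ) : k / b * b + (M.sample k).2.2 ≤ k := by
  have := M.localIndex_le_mod k
  have := Nat.div_add_mod' k b
  omega

theorem sample_of_succ {k j : ℕ} (h : (M.sample (k + 1)).2.2 = j + 1) :
    M.sample k = ((k + 1) / b, (M.sample (k + 1)).2.1, j) := by
  have hl := M.sample_lt (k + 1)
  have hk := M.eq_of_sample (k + 1)
  rw [h] at hl hk
  have h2 := M.sample_eq (Nat.lt_of_succ_lt hl)
  have hk' := Nat.add_right_cancel (hk.trans (add_assoc _ j 1).symm)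
  rwa [← hk'] at h2

theorem div_of_localIndex_succ {k j : ℕ} (h : (M.sample (k + 1)).2.2 = j + 1) :
    (k + 1) / b = k / b :=
  (congrArg Prod.fst (M.sample_of_succ h)).symm

theorem localIndex_of_succ {k j : ℕ} (h : (M.sample (k + 1)).2.2 = j + 1) :
    (M.sample k).2.2 = j :=
  congrArg (fun a => a.2.2) (M.sample_of_succ h)

theorem gradNode_of_zero {k : ℕ} (h : (M.sample k).2.2 = 0) : M.gradNode k = 2 * (k / b * b) := by
  simp [gradNode, h]

theorem gradNode_of_succ {k j : ℕ} (h : (M.sample (k + 1)).2.2 = j + 1) :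
    M.gradNode (k + 1) = 2 * k + 1 := by
  simp only [gradNode, h]
  rw [if_neg (Nat.succ_ne_zero j)]
  omega

/-- Induction over the gradients: the local index is zero, or the gradient before it has been
computed by the same worker in the same round. -/
theorem localIndex_induction {P : ℕ → Prop} (zero : ∀ k, (M.sample k).2.2 = 0 → P k)
    (succ : ∀ k j, (M.sample (k + 1)).2.2 = j + 1 → P k → P (k + 1)) (k : ℕ) : P k := by
  induction k with
  | zero =>
    apply zero
    have := M.round_mul_add_localIndex_le 0
    omega
  | succ k ih =>
    rcases h : (M.sample (k + 1)).2.2 with _ | j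
    · exact zero _ h
    · exact succ k j h ih

end Schedule

/-! ### The main sequence and the global models -/

section Algorithm

variable {n b : ℕ} {E S : Type*} [AddCommGroup E] [Module ℝ E]
  (M : Schedule n b) (η : ℝ) (w₀ : E) (G : E → S → E) (ζ : ℕ × Fin n × ℕ → S)

theorem mainSequence_add (k m : ℕ) :
    mainSequence M η w₀ G ζ (k + m) = mainSequence M η w₀ G ζ k -
      η • ∑ v ∈ Finset.range m,
        G (localPoint M η w₀ G ζ (M.sample (k + v)).1 (M.sample (k + v)).2.1
          (M.sample (k + v)).2.2) (ζ (M.sample (k + v))) := by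
  induction m with
  | zero => simp
  | succ m ih =>
    rw [← add_assoc, mainSequence, ih, Finset.sum_range_succ, smul_add, sub_sub]

theorem sum_round {A : Type*} [AddCommMonoid A] (r : ℕ) (F : ℕ × Fin n × ℕ → A) :
    ∑ v ∈ Finset.range b, F (M.sample (r * b + v)) =
      ∑ i, ∑ j ∈ Finset.range (M.steps r i), F (r, i, j) := by
  simp_rw [← Fin.sum_univ_eq_sum_range (fun j => F (r, _, j))]
  rw [← Fintype.sum_sigma' (fun i (j : Fin (M.steps r i)) => F (r, i, (j : ℕ))),
    ← Fin.sum_univ_eq_sum_range (fun v => F (M.sample (r * b + v)))]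
  refine (Fintype.sum_equiv (finSigmaFinEquiv.trans (finCongr (M.sum_eq r))) _ _ ?_).symm
  rintro ⟨i, j⟩
  have h : ((finSigmaFinEquiv.trans (finCongr (M.sum_eq r))) ⟨i, j⟩ : ℕ) = _ :=
    finSigmaFinEquiv_val_eq_sum_filter i j
  rw [h, ← add_assoc, M.sample_eq j.2]

theorem mainSequence_mul (r : ℕ) :
    mainSequence M η w₀ G ζ (r * b) = globalModel M η w₀ G ζ r := by
  induction r with
  | zero => simp [mainSequence, globalModel]
  | succ r ih =>
    rw [add_mul, one_mul, mainSequence_add, ih, globalModel, sum_round M r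
      (fun a => G (localPoint M η w₀ G ζ a.1 a.2.1 a.2.2) (ζ a))]
    rfl

theorem mainSequence_sample {r : ℕ} {i : Fin n} {j : ℕ} (hj : j < M.steps r i) :
    mainSequence M η w₀ G ζ
        (r * b + ∑ l ∈ Finset.univ.filter (· < i), M.steps r l + j + 1) =
      mainSequence M η w₀ G ζ (r * b + ∑ l ∈ Finset.univ.filter (· < i), M.steps r l + j) -
        η • G (localPoint M η w₀ G ζ r i j) (ζ (r, i, j)) := by
  rw [mainSequence, M.sample_eq hj]

end Algorithm

/-! ### The computation tree -/

namespace ComputationTree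

variable {I : Type*} (T : ComputationTree I)

theorem depth_succ (k : ℕ) : T.depth (k + 1) = T.depth (T.base k) + 1 := by
  rw [depth]

theorem repr_succ (k : ℕ) : T.repr (k + 1) = (T.grad k, T.label k) ::ₘ T.repr (T.base k) := by
  rw [repr]

theorem self_mem_ancestors (y : ℕ) : y ∈ T.ancestors y := by
  cases y <;> simp [ancestors]

theorem mem_ancestors_succ {y k : ℕ} (h : y ∈ T.ancestors (T.base k)) :
    y ∈ T.ancestors (k + 1) := by
  rw [ancestors]
  exact Finset.mem_insert_of_mem h

theorem point_succ {E S : Type*} [AddCommGroup E] [Module ℝ E] (w₀ : E) (G : E → S → E)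
    (s : I → S) (k : ℕ) :
    T.point w₀ G s (k + 1) = T.point w₀ G s (T.base k) -
      T.step k • G (T.point w₀ G s (T.grad k)) (s (T.label k)) := by
  rw [point]

theorem depth_le_commonDepth {a y z : ℕ} (hy : a ∈ T.ancestors y) (hz : a ∈ T.ancestors z) :
    T.depth a ≤ T.commonDepth y z :=
  Finset.le_sup (Finset.mem_inter.2 ⟨hy, hz⟩)

theorem dist_le_of_mem_ancestors {a y z : ℕ} (hy : a ∈ T.ancestors y) (hz : a ∈ T.ancestors z) :
    T.dist y z ≤ max (T.depth y - T.depth a) (T.depth z - T.depth a) := by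
  have := T.depth_le_commonDepth hy hz
  unfold dist
  omega

end ComputationTree

section Tree

variable {n b : ℕ} (M : Schedule n b) (η : ℝ)

theorem decayingTree_base_two_mul (k : ℕ) : (decayingTree M η).base (2 * k) = M.gradNode k := by
  simp [decayingTree]

theorem decayingTree_base_two_mul_add_one (k : ℕ) :
    (decayingTree M η).base (2 * k + 1) = 2 * k := by
  have h1 : (2 * k + 1) % 2 = 1 := by omega
  have h2 : (2 * k + 1) / 2 = k := by omega
  simp [decayingTree, h1, h2]

theorem decayingTree_step_two_mul (k : ℕ) :
    (decayingTree M η).step (2 * k) = localStep b η (M.sample k).2.2 := by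
  simp [decayingTree]

theorem decayingTree_step_two_mul_add_one (k : ℕ) : (decayingTree M η).step (2 * k + 1) = η := by
  have h1 : (2 * k + 1) % 2 = 1 := by omega
  simp [decayingTree, h1]

theorem decayingTree_grad_two_mul (k : ℕ) : (decayingTree M η).grad (2 * k) = M.gradNode k := by
  simp [decayingTree]

theorem decayingTree_grad_two_mul_add_one (k : ℕ) :
    (decayingTree M η).grad (2 * k + 1) = M.gradNode k := by
  have h2 : (2 * k + 1) / 2 = k := by omega
  simp [decayingTree, h2]

theorem decayingTree_label_two_mul (k : ℕ) : (decayingTree M η).label (2 * k) = M.sample k := by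
  simp [decayingTree]

theorem decayingTree_label_two_mul_add_one (k : ℕ) :
    (decayingTree M η).label (2 * k + 1) = M.sample k := by
  have h2 : (2 * k + 1) / 2 = k := by omega
  simp [decayingTree, h2]

theorem decayingTree_isMainBranch (hη : 0 < η) :
    (decayingTree M η).IsMainBranch (fun k => 2 * k) (fun _ => η) (fun k => M.gradNode k)
      (fun k => M.sample k) :=
  ⟨rfl, fun k => ⟨2 * k + 1, rfl, decayingTree_base_two_mul_add_one M η k,
    decayingTree_step_two_mul_add_one M η k, hη, decayingTree_grad_two_mul_add_one M η k,
    decayingTree_label_two_mul_add_one M η k⟩⟩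

theorem decayingTree_depth_two_mul (k : ℕ) : (decayingTree M η).depth (2 * k) = k := by
  induction k with
  | zero => simp [ComputationTree.depth]
  | succ k ih =>
    rw [mul_add, mul_one, ComputationTree.depth_succ, decayingTree_base_two_mul_add_one, ih]

theorem decayingTree_depth_gradNode (k : ℕ) :
    (decayingTree M η).depth (M.gradNode k) = k / b * b + (M.sample k).2.2 := by
  induction k using M.localIndex_induction with
  | zero k h =>
    rw [M.gradNode_of_zero h, decayingTree_depth_two_mul, h, add_zero]
  | succ k j h ih =>
    rw [M.gradNode_of_succ h, ComputationTree.depth_succ, decayingTree_base_two_mul, ih, h,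
      M.localIndex_of_succ h, M.div_of_localIndex_succ h, add_assoc]

theorem decayingTree_mem_ancestors_two_mul {i k : ℕ} (h : i ≤ k) :
    2 * i ∈ (decayingTree M η).ancestors (2 * k) := by
  induction k, h using Nat.le_induction with
  | base => exact ComputationTree.self_mem_ancestors _ _
  | succ k _ ih =>
    rw [mul_add, mul_one]
    apply ComputationTree.mem_ancestors_succ
    rwa [decayingTree_base_two_mul_add_one]

theorem decayingTree_mem_ancestors_gradNode (k : ℕ) :
    2 * (k / b * b) ∈ (decayingTree M η).ancestors (M.gradNode k) := by
  induction k using M.localIndex_induction with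
  | zero k h =>
    rw [M.gradNode_of_zero h]
    exact ComputationTree.self_mem_ancestors _ _
  | succ k j h ih =>
    rw [M.gradNode_of_succ h, M.div_of_localIndex_succ h]
    apply ComputationTree.mem_ancestors_succ
    rwa [decayingTree_base_two_mul]

theorem decayingTree_dist_le (k : ℕ) :
    (decayingTree M η).dist (2 * k) (M.gradNode k) ≤ b - 1 := by
  refine (ComputationTree.dist_le_of_mem_ancestors _
    (decayingTree_mem_ancestors_two_mul M η (Nat.div_mul_le_self k b))
    (decayingTree_mem_ancestors_gradNode M η k)).trans ?_
  rw [decayingTree_depth_gradNode, decayingTree_depth_two_mul, decayingTree_depth_two_mul]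
  have h1 := M.localIndex_le_mod k
  have h2 := Nat.mod_lt k M.pos
  have h3 := Nat.div_add_mod' k b
  omega

theorem decayingTree_distBranch_le (k : ℕ) :
    (decayingTree M η).distBranch (M.gradNode k) (fun k => 2 * k) ≤ (M.sample k).2.2 := by
  refine (ciInf_le (OrderBot.bddBelow _) (k / b * b)).trans ?_
  refine (ComputationTree.dist_le_of_mem_ancestors _
    (decayingTree_mem_ancestors_gradNode M η k)
    (ComputationTree.self_mem_ancestors _ _)).trans ?_
  rw [decayingTree_depth_gradNode, decayingTree_depth_two_mul]
  omega

theorem decayingTree_repr_two_mul_succ (k : ℕ) :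
    (decayingTree M η).repr (2 * (k + 1)) =
      (M.gradNode k, M.sample k) ::ₘ (decayingTree M η).repr (2 * k) := by
  rw [mul_add, mul_one, ComputationTree.repr_succ, decayingTree_base_two_mul_add_one,
    decayingTree_grad_two_mul_add_one, decayingTree_label_two_mul_add_one]

theorem decayingTree_repr_mono {i k : ℕ} (h : i ≤ k) :
    (decayingTree M η).repr (2 * i) ≤ (decayingTree M η).repr (2 * k) := by
  induction k, h using Nat.le_induction with
  | base => exact le_rfl
  | succ k _ ih =>
    rw [decayingTree_repr_two_mul_succ]
    exact ih.trans (Multiset.le_cons_self _ _)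

theorem decayingTree_repr_gradNode_le (k : ℕ) :
    (decayingTree M η).repr (M.gradNode k) ≤ (decayingTree M η).repr (2 * k) := by
  induction k using M.localIndex_induction with
  | zero k h =>
    rw [M.gradNode_of_zero h]
    exact decayingTree_repr_mono M η (Nat.div_mul_le_self k b)
  | succ k j h ih =>
    rw [M.gradNode_of_succ h, ComputationTree.repr_succ, decayingTree_base_two_mul,
      decayingTree_grad_two_mul, decayingTree_label_two_mul, decayingTree_repr_two_mul_succ]
    exact Multiset.cons_le_cons _ ih

/-! ### Points carried by the nodes of the tree -/

variable {E S : Type*} [AddCommGroup E] [Module ℝ E] (w₀ : E) (G : E → S → E)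
  (ζ : ℕ × Fin n × ℕ → S)

theorem decayingTree_point_two_mul_succ (k : ℕ) :
    (decayingTree M η).point w₀ G ζ (2 * (k + 1)) = (decayingTree M η).point w₀ G ζ (2 * k) -
      η • G ((decayingTree M η).point w₀ G ζ (M.gradNode k)) (ζ (M.sample k)) := by
  rw [mul_add, mul_one, ComputationTree.point_succ, decayingTree_base_two_mul_add_one,
    decayingTree_grad_two_mul_add_one, decayingTree_label_two_mul_add_one,
    decayingTree_step_two_mul_add_one]

theorem decayingTree_point_two_mul_add_one (k : ℕ) :
    (decayingTree M η).point w₀ G ζ (2 * k + 1) =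
      (decayingTree M η).point w₀ G ζ (M.gradNode k) - localStep b η (M.sample k).2.2 •
        G ((decayingTree M η).point w₀ G ζ (M.gradNode k)) (ζ (M.sample k)) := by
  rw [ComputationTree.point_succ, decayingTree_base_two_mul, decayingTree_grad_two_mul,
    decayingTree_label_two_mul, decayingTree_step_two_mul]

/-- The two claims need each other: a main step uses the local point, and a local point comes either
from the round start, itself on the main branch, or from the preceding gradient. -/
theorem decayingTree_point_eq (k : ℕ) :
    (decayingTree M η).point w₀ G ζ (2 * k) = mainSequence M η w₀ G ζ k ∧
      (decayingTree M η).point w₀ G ζ (M.gradNode k) =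
        localPoint M η w₀ G ζ (M.sample k).1 (M.sample k).2.1 (M.sample k).2.2 := by
  induction k using Nat.strong_induction_on with
  | _ k ih =>
    have h1 : (decayingTree M η).point w₀ G ζ (2 * k) = mainSequence M η w₀ G ζ k := by
      cases k with
      | zero => simp [ComputationTree.point, mainSequence]
      | succ k =>
        rw [decayingTree_point_two_mul_succ, (ih k k.lt_succ_self).1, (ih k k.lt_succ_self).2,
          mainSequence]
    refine ⟨h1, ?_⟩
    rcases h : (M.sample k).2.2 with _ | j
    · rw [M.gradNode_of_zero h, localPoint, localIterate, M.sample_fst,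
        ← mainSequence_mul M η w₀ G ζ]
      rcases (Nat.div_mul_le_self k b).lt_or_eq with hlt | heq
      · exact (ih _ hlt).1
      · rw [heq, h1]
    · cases k with
      | zero =>
        have := M.round_mul_add_localIndex_le 0
        omega
      | succ k =>
        rw [M.gradNode_of_succ h, decayingTree_point_two_mul_add_one, (ih k k.lt_succ_self).2,
          M.sample_of_succ h]
        rfl

theorem decayingTree_point_two_mul_add_one_eq (k : ℕ) :
    (decayingTree M η).point w₀ G ζ (2 * k + 1) =
      localPoint M η w₀ G ζ (M.sample k).1 (M.sample k).2.1 ((M.sample k).2.2 + 1) := by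
  rw [decayingTree_point_two_mul_add_one, (decayingTree_point_eq M η w₀ G ζ k).2]
  rfl

end Tree

/-! ### Independence of the current sample from the past -/

section Independence

variable {Ω S : Type*} [MeasurableSpace Ω] [MeasurableSpace S] {μ : Measure Ω}

/-- Every subset of the countable space `H` is measurable, so preimages under `φ` can be rewritten
as preimages under `g`. -/
theorem measurable_of_factorsThrough {Ω H α : Type*} {m : MeasurableSpace Ω} [Countable H]
    [MeasurableSpace H] [MeasurableSingletonClass H] [MeasurableSpace α] {g : Ω → H} {φ : Ω → α} (hg : Measurable g)
    (h : Function.FactorsThrough φ g) : Measurable φ := by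
  intro A _
  have : φ ⁻¹' A = g ⁻¹' (g '' (φ ⁻¹' A)) := by
    refine (Set.subset_preimage_image _ _).antisymm ?_
    rintro ω ⟨ω', hω', heq⟩
    rw [Set.mem_preimage, h heq.symm]
    exact hω'
  rw [this]
  exact hg (Set.to_countable _).measurableSet

theorem IndepFun.prodMk_of_prodMk [IsProbabilityMeasure μ] {α β γ : Type*} [MeasurableSpace α]
    [MeasurableSpace β] [MeasurableSpace γ] {X : Ω → α} {Y : Ω → β} {Z : Ω → γ}
    (hX : Measurable X) (hY : Measurable Y) (hZ : Measurable Z) (hXY : IndepFun X Y μ)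
    (hXYZ : IndepFun (fun ω => (X ω, Y ω)) Z μ) : IndepFun X (fun ω => (Y ω, Z ω)) μ := by
  have hYZ : IndepFun Y Z μ := hXYZ.comp measurable_snd measurable_id
  rw [indepFun_iff_map_prod_eq_prod_map_map hX.aemeasurable hY.aemeasurable] at hXY
  rw [indepFun_iff_map_prod_eq_prod_map_map hY.aemeasurable hZ.aemeasurable] at hYZ
  rw [indepFun_iff_map_prod_eq_prod_map_map (hX.prodMk hY).aemeasurable hZ.aemeasurable,
    hXY] at hXYZ
  rw [indepFun_iff_map_prod_eq_prod_map_map hX.aemeasurable (hY.prodMk hZ).aemeasurable, hYZ]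
  have := Measure.isProbabilityMeasure_map hX.aemeasurable (μ := μ)
  have := Measure.isProbabilityMeasure_map hY.aemeasurable (μ := μ)
  have := Measure.isProbabilityMeasure_map hZ.aemeasurable (μ := μ)
  rw [← (measurePreserving_prodAssoc (μ.map X) (μ.map Y) (μ.map Z)).map_eq, ← hXYZ,
    Measure.map_map MeasurableEquiv.prodAssoc.measurable ((hX.prodMk hY).prodMk hZ)]
  rfl

variable {n b : ℕ}

/-- Two sources of independence are glued by `IndepFun.prodMk_of_prodMk`: the sample is independent
of the others of its round, and the whole round is independent of the history and the earlier
rounds. -/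
theorem indepFun_sample_finset [IsProbabilityMeasure μ] {N : Type*} [MeasurableSpace N]
    {ζ : ℕ × Fin n × ℕ → Ω → S}
    (hζ : ∀ a, Measurable (ζ a)) (hindep : iIndepFun ζ μ) {r : ℕ} {hist : Ω → N}
    (hhist : Measurable hist)
    (hround : IndepFun (fun ω (a : Fin n × ℕ) => ζ (r, a) ω)
      (fun ω => (hist ω, fun (a : Fin r × Fin n × ℕ) => ζ ((a.1 : ℕ), a.2) ω)) μ)
    (a : Fin n × ℕ) (s : Finset (ℕ × Fin n × ℕ)) (has : (r, a) ∉ s) (hs : ∀ c ∈ s, c.1 ≤ r) :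
    IndepFun (ζ (r, a)) (fun ω => (hist ω, fun c : s => ζ c ω)) μ := by
  classical
  set t : Finset (Fin n × ℕ) := (s.filter (fun c => c.1 = r)).image Prod.snd with ht
  have hat : a ∉ t := by
    intro h
    simp only [ht, Finset.mem_image, Finset.mem_filter] at h
    obtain ⟨c, ⟨hc, hcr⟩, rfl⟩ := h
    exact has (by rw [← hcr]; exact hc)
  have hmem : ∀ c : s, ¬ c.1.1 < r → c.1.2 ∈ t := fun c hc =>
    Finset.mem_image_of_mem _ (Finset.mem_filter.2 ⟨c.2, (hs c c.2).antisymm (not_lt.1 hc)⟩)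
  have hind : iIndepFun (fun a' : Fin n × ℕ => ζ (r, a')) μ :=
    hindep.precomp (g := fun a' : Fin n × ℕ => (r, a')) (fun x y h => (Prod.mk.inj h).2)
  have h1 : IndepFun (ζ (r, a)) (fun ω (c : t) => ζ (r, c) ω) μ :=
    (hind.indepFun_finset {a} t (Finset.disjoint_singleton_left.2 hat) (fun _ => hζ _)).comp
      (measurable_pi_apply (⟨a, Finset.mem_singleton_self a⟩ : ({a} : Finset (Fin n × ℕ))))
      measurable_id
  have h2 : IndepFun (fun ω => (ζ (r, a) ω, fun (c : t) => ζ (r, c) ω))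
      (fun ω => (hist ω, fun (a : Fin r × Fin n × ℕ) => ζ ((a.1 : ℕ), a.2) ω)) μ :=
    hround.comp (φ := fun Z : Fin n × ℕ → S => (Z a, fun c : t => Z c)) (ψ := id)
      (by fun_prop) measurable_id
  have h3 := IndepFun.prodMk_of_prodMk (hζ _) (by fun_prop) (by fun_prop) h1 h2
  have hΦ : Measurable (fun (p : (t → S) × N × (Fin r × Fin n × ℕ → S)) =>
      (p.2.1, fun c : s => if h : c.1.1 < r then p.2.2 (⟨c.1.1, h⟩, c.1.2)
        else p.1 ⟨c.1.2, hmem c h⟩)) := by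
    refine Measurable.prodMk (by fun_prop) (measurable_pi_lambda _ fun c => ?_)
    split_ifs <;> fun_prop
  refine (h3.comp (φ := id) measurable_id hΦ).congr (ae_of_all _ fun _ => rfl)
    (ae_of_all _ fun ω => ?_)
  refine congrArg (Prod.mk (hist ω)) (funext fun c => ?_)
  by_cases h : c.1.1 < r
  · simp [h]
  · have hr : c.1.1 = r := (hs c c.2).antisymm (not_lt.1 h)
    simp [← hr]

variable (M : Ω → Schedule n b) (ζ : ℕ × Fin n × ℕ → Ω → S)

/-- The sample used by the `k`-th stochastic gradient. -/
def usedSample (k : ℕ) (ω : Ω) : S := ζ ((M ω).sample k) ω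

/-- The numbers of local steps up to the round of the `k`-th stochastic gradient, and the samples
of the gradients before it. -/
def pastData (k : ℕ) (ω : Ω) : (Fin (k / b + 1) → Fin n → ℕ) × (Fin k → S) :=
  (fun s i => (M ω).steps s i, fun i => usedSample M ζ i ω)

variable {M ζ}

theorem measurable_sample (hM : ∀ r i, Measurable (fun ω => (M ω).steps r i)) (k : ℕ) :
    Measurable (fun ω => (M ω).sample k) :=
  measurable_of_factorsThrough (g := fun ω => (M ω).steps (k / b))
    (measurable_pi_lambda _ fun i => hM _ i) (fun _ _ h => Schedule.sample_congr h)

theorem measurable_usedSample (hM : ∀ r i, Measurable (fun ω => (M ω).steps r i))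
    (hζ : ∀ a, Measurable (ζ a)) (k : ℕ) : Measurable (usedSample M ζ k) :=
  (measurable_from_prod_countable_right (f := Function.uncurry ζ) hζ).comp
    ((measurable_sample hM k).prodMk measurable_id)

theorem measurable_pastData (hM : ∀ r i, Measurable (fun ω => (M ω).steps r i))
    (hζ : ∀ a, Measurable (ζ a)) (k : ℕ) : Measurable (pastData M ζ k) :=
  (measurable_pi_lambda _ fun _ => measurable_pi_lambda _ fun _ => hM _ _).prodMk
    (measurable_pi_lambda _ fun _ => measurable_usedSample hM hζ _)

theorem measure_usedSample_inter_pastData [IsProbabilityMeasure μ] {D : Measure S}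
    (hM : ∀ r i, Measurable (fun ω => (M ω).steps r i))
    (hζ : ∀ a, Measurable (ζ a)) (hlaw : ∀ a, μ.map (ζ a) = D) (hindep : iIndepFun ζ μ)
    (hMζ : ∀ r : ℕ, IndepFun
      (fun ω (a : Fin n × ℕ) => ζ (r, a) ω)
      (fun ω => ((fun (s : Fin (r + 1)) (i : Fin n) => (M ω).steps s i),
        (fun (a : Fin r × Fin n × ℕ) => ζ ((a.1 : ℕ), a.2) ω))) μ)
    (k : ℕ) {A : Set S} (hA : MeasurableSet A)
    {B : Set ((Fin (k / b + 1) → Fin n → ℕ) × (Fin k → S))} (hB : MeasurableSet B) :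
    μ (usedSample M ζ k ⁻¹' A ∩ pastData M ζ k ⁻¹' B) = D A * μ (pastData M ζ k ⁻¹' B) := by
  classical
  set hist : Ω → (Fin (k / b + 1) → Fin n → ℕ) := fun ω s i => (M ω).steps s i with hhist_def
  have hhist : Measurable hist :=
    measurable_pi_lambda _ fun _ => measurable_pi_lambda _ fun _ => hM _ _
  -- On each event `hist = h` the names of all samples up to number `k` are deterministic, so
  -- independence for fixed names applies there.
  have hsplit : ∀ E : Set Ω, μ E = ∑' h, μ (hist ⁻¹' {h} ∩ E) := by
    intro E
    have h1 := tsum_measure_preimage_singleton (μ := μ.restrict E) (Set.countable_univ)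
      (f := hist) (fun h _ => hhist (measurableSet_singleton h))
    rw [Set.preimage_univ, Measure.restrict_apply_univ] at h1
    rw [← h1, tsum_univ (fun h => (μ.restrict E) (hist ⁻¹' {h}))]
    exact tsum_congr fun h => Measure.restrict_apply (hhist (measurableSet_singleton h))
  rw [hsplit, hsplit (pastData M ζ k ⁻¹' B), ← ENNReal.tsum_mul_left]
  refine tsum_congr fun h => ?_
  rcases (hist ⁻¹' {h}).eq_empty_or_nonempty with hne | ⟨ω₀, hω₀⟩
  · simp [hne]
  set s : Finset (ℕ × Fin n × ℕ) := (Finset.range k).image (M ω₀).sample with hs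
  have hsample : ∀ ω ∈ hist ⁻¹' {h}, ∀ i ≤ k, (M ω).sample i = (M ω₀).sample i := by
    intro ω hω i hi
    apply Schedule.sample_congr
    have h1 : hist ω = hist ω₀ :=
      (Set.mem_singleton_iff.1 hω).trans (Set.mem_singleton_iff.1 hω₀).symm
    exact congrFun h1 ⟨i / b, Nat.lt_succ_of_le (Nat.div_le_div_right hi)⟩
  have hind := indepFun_sample_finset hζ hindep hhist (hMζ (k / b)) ((M ω₀).sample k).2 s
    (by
      rw [hs, Finset.mem_image]
      rintro ⟨i, hi, heq⟩
      have := (M ω₀).sample_injective (a₁ := i) (a₂ := k) heq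
      simp [this] at hi)
    (by
      intro c hc
      obtain ⟨i, hi, rfl⟩ := Finset.mem_image.1 hc
      exact Nat.div_le_div_right (Finset.mem_range.1 hi).le)
  have hsm : ∀ i : Fin k, (M ω₀).sample i ∈ s := fun i =>
    Finset.mem_image_of_mem _ (Finset.mem_range.2 i.2)
  set B' : Set ((Fin (k / b + 1) → Fin n → ℕ) × (s → S)) :=
    {p | p.1 = h ∧ (p.1, fun i : Fin k => p.2 ⟨(M ω₀).sample i, hsm i⟩) ∈ B} with hB'_def
  have hB' : MeasurableSet B' := by
    apply MeasurableSet.inter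
    · exact measurable_fst (measurableSet_singleton h)
    · exact (Measurable.prodMk measurable_fst (measurable_pi_lambda _ fun i =>
        (measurable_pi_apply _).comp measurable_snd)) hB
  have hpast : ∀ ω ∈ hist ⁻¹' {h}, pastData M ζ k ω =
      (hist ω, fun i : Fin k => ζ ((M ω₀).sample i) ω) := by
    intro ω hω
    refine congrArg (Prod.mk (hist ω)) (funext fun i => ?_)
    simp only [usedSample]
    rw [hsample ω hω i i.2.le]
  have hE2 : hist ⁻¹' {h} ∩ pastData M ζ k ⁻¹' B =
      (fun ω => (hist ω, fun c : s => ζ c ω)) ⁻¹' B' := by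
    ext ω
    constructor
    · rintro ⟨hω, hωB⟩
      rw [Set.mem_preimage, hpast ω hω] at hωB
      exact ⟨hω, hωB⟩
    · rintro ⟨hω, hωB⟩
      refine ⟨hω, ?_⟩
      rw [Set.mem_preimage, hpast ω hω]
      exact hωB
  have hE1 : hist ⁻¹' {h} ∩ (usedSample M ζ k ⁻¹' A ∩ pastData M ζ k ⁻¹' B) =
      ζ ((M ω₀).sample k) ⁻¹' A ∩ (hist ⁻¹' {h} ∩ pastData M ζ k ⁻¹' B) := by
    ext ω
    simp only [Set.mem_inter_iff, Set.mem_preimage, usedSample]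
    constructor
    · rintro ⟨h1, h2, h3⟩
      rw [hsample ω h1 k le_rfl] at h2
      exact ⟨h2, h1, h3⟩
    · rintro ⟨h2, h1, h3⟩
      rw [← hsample ω h1 k le_rfl] at h2
      exact ⟨h1, h2, h3⟩
  rw [hE1, hE2, ← hlaw ((M ω₀).sample k), Measure.map_apply (hζ _) hA]
  exact hind.measure_inter_preimage_eq_mul _ _ hA hB'

theorem map_usedSample_and_indepFun [IsProbabilityMeasure μ] {D : Measure S}
    (hM : ∀ r i, Measurable (fun ω => (M ω).steps r i))
    (hζ : ∀ a, Measurable (ζ a)) (hlaw : ∀ a, μ.map (ζ a) = D) (hindep : iIndepFun ζ μ)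
    (hMζ : ∀ r : ℕ, IndepFun
      (fun ω (a : Fin n × ℕ) => ζ (r, a) ω)
      (fun ω => ((fun (s : Fin (r + 1)) (i : Fin n) => (M ω).steps s i),
        (fun (a : Fin r × Fin n × ℕ) => ζ ((a.1 : ℕ), a.2) ω))) μ)
    (k : ℕ) :
    μ.map (usedSample M ζ k) = D ∧ IndepFun (usedSample M ζ k) (pastData M ζ k) μ := by
  have key := fun A hA B hB =>
    measure_usedSample_inter_pastData hM hζ hlaw hindep hMζ k (A := A) hA (B := B) hB
  have hmap : ∀ A, MeasurableSet A → μ (usedSample M ζ k ⁻¹' A) = D A := by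
    intro A hA
    simpa using key A hA Set.univ MeasurableSet.univ
  refine ⟨Measure.ext fun A hA => ?_, ?_⟩
  · rw [Measure.map_apply (measurable_usedSample hM hζ k) hA, hmap A hA]
  · rw [indepFun_iff_measure_inter_preimage_eq_mul]
    intro A B hA hB
    rw [key A hA B hB, hmap A hA]

end Independence

/-! ### Fresh noise -/

section Noise

variable {d : ℕ} {Ω S : Type*} {𝓖 : MeasurableSpace Ω} [mΩ : MeasurableSpace Ω]
  [MeasurableSpace S] {μ : Measure Ω} {D : Measure S} {f : EuclideanSpace ℝ (Fin d) → ℝ}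
  {G : EuclideanSpace ℝ (Fin d) → S → EuclideanSpace ℝ (Fin d)} {L σ : ℝ}

theorem integrable_inner_of_memLp {u v : Ω → EuclideanSpace ℝ (Fin d)} (hu : MemLp u 2 μ)
    (hv : MemLp v 2 μ) : Integrable (fun ω => inner ℝ (u ω) (v ω)) μ :=
  (hu.norm.integrable_mul hv.norm).mono' (hu.1.inner hv.1)
    (ae_of_all _ fun ω => norm_inner_le_norm (u ω) (v ω))

theorem memLp_gradient [IsFiniteMeasure μ] (hf : IsSmooth f L)
    {x : Ω → EuclideanSpace ℝ (Fin d)} (hx : MemLp x 2 μ) :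
    MemLp (fun ω => gradient f (x ω)) 2 μ := by
  have h1 : MemLp (fun ω => gradient f (x ω) - gradient f 0) 2 μ := by
    refine hx.of_le_mul (c := L)
      ((hf.continuous_gradient.comp_aestronglyMeasurable hx.1).sub aestronglyMeasurable_const)
      (ae_of_all _ fun ω => ?_)
    simpa using hf.lipschitz (x ω) 0
  exact (h1.add (memLp_const (gradient f 0))).ae_eq (ae_of_all _ fun ω => by simp)

theorem measurable_noise (hf : IsSmooth f L) (hG : IsStochasticGradient f G D σ) :
    Measurable (fun p : EuclideanSpace ℝ (Fin d) × S => G p.1 p.2 - gradient f p.1) :=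
  hG.measurable.sub (hf.continuous_gradient.measurable.comp measurable_fst)

variable [IsProbabilityMeasure μ]

theorem map_prodMk_eq_prod_of_indep (h𝓖 : 𝓖 ≤ mΩ) {ξ : Ω → S}
    (hξ : Measurable ξ) (hlaw : μ.map ξ = D)
    (hind : Indep (MeasurableSpace.comap ξ inferInstance) 𝓖 μ) {α : Type*} [MeasurableSpace α]
    {Y : Ω → α} (hY : Measurable[𝓖] Y) :
    μ.map (fun ω => (Y ω, ξ ω)) = (μ.map Y).prod D := by
  rw [← hlaw]
  refine (indepFun_iff_map_prod_eq_prod_map_map (hY.mono h𝓖 le_rfl).aemeasurable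
    hξ.aemeasurable).1 ?_
  rw [IndepFun_iff_Indep]
  exact (indep_of_indep_of_le_right hind hY.comap_le).symm

variable [IsProbabilityMeasure D]

theorem integral_noise (hG : IsStochasticGradient f G D σ) (x : EuclideanSpace ℝ (Fin d)) :
    ∫ s, (G x s - gradient f x) ∂D = 0 := by
  rw [integral_sub (hG.integrable x) (integrable_const _), hG.unbiased]
  simp

variable {ξ : Ω → S} {z : Ω → EuclideanSpace ℝ (Fin d)}

/-- The joint law of `(c, z)` and `ξ` is a product, so Fubini integrates the fresh sample first,
with `c` and `z` frozen, where the variance bound holds pointwise. No moment of `z` is needed. -/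
theorem memLp_smul_noise (hf : IsSmooth f L) (hG : IsStochasticGradient f G D σ) (h𝓖 : 𝓖 ≤ mΩ)
    (hξ : Measurable ξ) (hlaw : μ.map ξ = D)
    (hind : Indep (MeasurableSpace.comap ξ inferInstance) 𝓖 μ) (hz : Measurable[𝓖] z)
    {c : Ω → ℝ} (hc : Measurable[𝓖] c) (hc2 : Integrable (fun ω => c ω ^ 2) μ) :
    MemLp (fun ω => c ω • (G (z ω) (ξ ω) - gradient f (z ω))) 2 μ ∧
      ∫ ω, ‖c ω • (G (z ω) (ξ ω) - gradient f (z ω))‖ ^ 2 ∂μ ≤ σ ^ 2 * ∫ ω, c ω ^ 2 ∂μ := by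
  have hY : Measurable[𝓖] (fun ω => (c ω, z ω)) := hc.prodMk hz
  have hY' : Measurable (fun ω => (c ω, z ω)) := hY.mono h𝓖 le_rfl
  have hmap := map_prodMk_eq_prod_of_indep h𝓖 hξ hlaw hind hY
  have := Measure.isProbabilityMeasure_map hY'.aemeasurable (μ := μ)
  set ν := μ.map (fun ω => (c ω, z ω)) with hν
  set Φ : (ℝ × EuclideanSpace ℝ (Fin d)) × S → ℝ :=
    fun p => p.1.1 ^ 2 * ‖G p.1.2 p.2 - gradient f p.1.2‖ ^ 2 with hΦ
  have hN : Measurable (fun p : (ℝ × EuclideanSpace ℝ (Fin d)) × S =>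
      G p.1.2 p.2 - gradient f p.1.2) :=
    (measurable_noise hf hG).comp
      ((measurable_snd.comp measurable_fst).prodMk measurable_snd)
  have hΦm : Measurable Φ := by fun_prop
  have hc2' : Integrable (fun y : ℝ × EuclideanSpace ℝ (Fin d) => y.1 ^ 2) ν :=
    (integrable_map_measure (by fun_prop) hY'.aemeasurable).2 hc2
  have hbound : ∀ y : ℝ × EuclideanSpace ℝ (Fin d),
      ∫ s, Φ (y, s) ∂D ≤ σ ^ 2 * y.1 ^ 2 := by
    intro y
    simp only [hΦ, integral_const_mul]
    rw [mul_comm]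
    exact mul_le_mul_of_nonneg_right (hG.variance_le y.2) (sq_nonneg _)
  have hΦi : Integrable Φ (ν.prod D) := by
    rw [integrable_prod_iff hΦm.aestronglyMeasurable]
    refine ⟨ae_of_all _ fun y => (hG.integrable_sq y.2).const_mul (y.1 ^ 2), ?_⟩
    refine (hc2'.const_mul (σ ^ 2)).mono'
      (hΦm.aestronglyMeasurable.norm.integral_prod_right') (ae_of_all _ fun y => ?_)
    rw [Real.norm_of_nonneg (integral_nonneg fun _ => norm_nonneg _)]
    refine le_trans (le_of_eq ?_) (hbound y)
    exact integral_congr_ae (ae_of_all _ fun s =>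
      Real.norm_of_nonneg (mul_nonneg (sq_nonneg _) (sq_nonneg _)))
  have hpair : Measurable (fun ω => ((c ω, z ω), ξ ω)) := hY'.prodMk hξ
  have hsq : (fun ω => ‖c ω • (G (z ω) (ξ ω) - gradient f (z ω))‖ ^ 2) =
      Φ ∘ (fun ω => ((c ω, z ω), ξ ω)) := by
    funext ω
    simp [hΦ, norm_smul, mul_pow]
  have hm : Measurable (fun ω => c ω • (G (z ω) (ξ ω) - gradient f (z ω))) :=
    (hc.mono h𝓖 le_rfl).smul (hN.comp hpair)
  constructor
  · rw [memLp_two_iff_integrable_sq_norm hm.aestronglyMeasurable, hsq]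
    rw [← hmap] at hΦi
    exact (integrable_map_measure hΦm.aestronglyMeasurable hpair.aemeasurable).1 hΦi
  · rw [hsq]
    calc ∫ ω, (Φ ∘ fun ω => ((c ω, z ω), ξ ω)) ω ∂μ = ∫ p, Φ p ∂(ν.prod D) := by
          rw [← hmap, integral_map hpair.aemeasurable hΦm.aestronglyMeasurable]
          rfl
      _ = ∫ y, ∫ s, Φ (y, s) ∂D ∂ν := integral_prod _ hΦi
      _ ≤ ∫ y, σ ^ 2 * y.1 ^ 2 ∂ν :=
          integral_mono hΦi.integral_prod_left (hc2'.const_mul _) hbound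
      _ = σ ^ 2 * ∫ ω, c ω ^ 2 ∂μ := by
          rw [integral_const_mul, hν, integral_map hY'.aemeasurable (by fun_prop)]

theorem integral_inner_noise (hf : IsSmooth f L) (hG : IsStochasticGradient f G D σ) (h𝓖 : 𝓖 ≤ mΩ)
    (hξ : Measurable ξ) (hlaw : μ.map ξ = D)
    (hind : Indep (MeasurableSpace.comap ξ inferInstance) 𝓖 μ) (hz : Measurable[𝓖] z)
    {U : Ω → EuclideanSpace ℝ (Fin d)} (hU : Measurable[𝓖] U)
    (hUN : Integrable (fun ω => inner ℝ (U ω) (G (z ω) (ξ ω) - gradient f (z ω))) μ) :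
    ∫ ω, inner ℝ (U ω) (G (z ω) (ξ ω) - gradient f (z ω)) ∂μ = 0 := by
  have hY : Measurable[𝓖] (fun ω => (U ω, z ω)) := hU.prodMk hz
  have hY' : Measurable (fun ω => (U ω, z ω)) := hY.mono h𝓖 le_rfl
  have hmap := map_prodMk_eq_prod_of_indep h𝓖 hξ hlaw hind hY
  have := Measure.isProbabilityMeasure_map hY'.aemeasurable (μ := μ)
  set Φ : (EuclideanSpace ℝ (Fin d) × EuclideanSpace ℝ (Fin d)) × S → ℝ :=
    fun p => inner ℝ p.1.1 (G p.1.2 p.2 - gradient f p.1.2) with hΦ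
  have hN : Measurable (fun p : (EuclideanSpace ℝ (Fin d) × EuclideanSpace ℝ (Fin d)) × S =>
      G p.1.2 p.2 - gradient f p.1.2) :=
    (measurable_noise hf hG).comp
      ((measurable_snd.comp measurable_fst).prodMk measurable_snd)
  have hΦm : Measurable Φ := (measurable_fst.comp measurable_fst).inner hN
  have hpair : Measurable (fun ω => ((U ω, z ω), ξ ω)) := hY'.prodMk hξ
  have hΦi : Integrable Φ ((μ.map (fun ω => (U ω, z ω))).prod D) := by
    rw [← hmap]
    exact (integrable_map_measure hΦm.aestronglyMeasurable hpair.aemeasurable).2 hUN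
  calc ∫ ω, inner ℝ (U ω) (G (z ω) (ξ ω) - gradient f (z ω)) ∂μ
      = ∫ p, Φ p ∂((μ.map (fun ω => (U ω, z ω))).prod D) := by
        rw [← hmap, integral_map hpair.aemeasurable hΦm.aestronglyMeasurable]
    _ = ∫ y, ∫ s, Φ (y, s) ∂D ∂(μ.map (fun ω => (U ω, z ω))) := integral_prod _ hΦi
    _ = 0 := by
        refine integral_eq_zero_of_ae (ae_of_all _ fun y => ?_)
        simp only [hΦ, Pi.zero_apply]
        have hi : Integrable (fun s => G y.2 s - gradient f y.2) D :=
          (hG.integrable y.2).sub (integrable_const _)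
        exact (integral_inner hi y.1).trans (by rw [integral_noise hG, inner_zero_right])

end Noise

/-! ### Stochastic gradient descent with local points -/

/-- The process behind the method, with the filtration `𝓕`: `X` is the main sequence, `Z k` the
point at which the `k`-th stochastic gradient is evaluated, `ξ k` its sample and `J k` its local
index. Rounds consist of `b` gradients. -/
structure IsLocalSGDProcess {d : ℕ} {Ω S : Type*} [mΩ : MeasurableSpace Ω] [MeasurableSpace S]
    (μ : Measure Ω) (D : Measure S)
    (G : EuclideanSpace ℝ (Fin d) → S → EuclideanSpace ℝ (Fin d))
    (w₀ : EuclideanSpace ℝ (Fin d)) (b : ℕ) (η : ℝ) (𝓕 : ℕ → MeasurableSpace Ω)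
    (X Z : ℕ → Ω → EuclideanSpace ℝ (Fin d)) (ξ : ℕ → Ω → S) (J : ℕ → Ω → ℕ) : Prop where
  pos : 0 < b
  le : ∀ k, 𝓕 k ≤ mΩ
  mono : Monotone 𝓕
  indep : ∀ k, Indep (MeasurableSpace.comap (ξ k) inferInstance) (𝓕 k) μ
  law : ∀ k, μ.map (ξ k) = D
  measurable_sample : ∀ k, Measurable[𝓕 (k + 1)] (ξ k)
  measurable_index : ∀ k, Measurable[𝓕 (k / b * b)] (J k)
  index_le : ∀ k ω, k / b * b + J k ω ≤ k
  main_zero : ∀ ω, X 0 ω = w₀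
  main_succ : ∀ k ω, X (k + 1) ω = X k ω - η • G (Z k ω) (ξ k ω)
  local_zero : ∀ k ω, J k ω = 0 → Z k ω = X (k / b * b) ω
  local_succ : ∀ k j ω, J (k + 1) ω = j + 1 → (k + 1) / b = k / b ∧ J k ω = j ∧
    Z (k + 1) ω = Z k ω - localStep b η j • G (Z k ω) (ξ k ω)

namespace IsLocalSGDProcess

variable {d b : ℕ} {Ω S : Type*} [mΩ : MeasurableSpace Ω] [MeasurableSpace S] {μ : Measure Ω}
  {D : Measure S} {f : EuclideanSpace ℝ (Fin d) → ℝ}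
  {G : EuclideanSpace ℝ (Fin d) → S → EuclideanSpace ℝ (Fin d)} {L σ η : ℝ}
  {w₀ : EuclideanSpace ℝ (Fin d)} {𝓕 : ℕ → MeasurableSpace Ω}
  {X Z : ℕ → Ω → EuclideanSpace ℝ (Fin d)} {ξ : ℕ → Ω → S} {J : ℕ → Ω → ℕ}

theorem measurable_sample' (hP : IsLocalSGDProcess μ D G w₀ b η 𝓕 X Z ξ J) (k : ℕ) :
    Measurable (ξ k) :=
  (hP.measurable_sample k).mono (hP.le _) le_rfl

theorem measurable_points (hP : IsLocalSGDProcess μ D G w₀ b η 𝓕 X Z ξ J)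
    (hG : IsStochasticGradient f G D σ) (k : ℕ) :
    Measurable[𝓕 k] (X k) ∧ Measurable[𝓕 k] (Z k) := by
  induction k using Nat.strong_induction_on with
  | _ k ih =>
    have hgrad : ∀ i < k, Measurable[𝓕 k] (fun ω => G (Z i ω) (ξ i ω)) := fun i hi =>
      hG.measurable.comp (((ih i hi).2.mono (hP.mono hi.le) le_rfl).prodMk
        ((hP.measurable_sample i).mono (hP.mono hi) le_rfl))
    have hX : Measurable[𝓕 k] (X k) := by
      cases k with
      | zero =>
        rw [show X 0 = fun _ => w₀ from funext hP.main_zero]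
        exact measurable_const
      | succ k =>
        rw [show X (k + 1) = fun ω => X k ω - η • G (Z k ω) (ξ k ω) from
          funext (hP.main_succ k)]
        exact ((ih k k.lt_succ_self).1.mono (hP.mono k.le_succ) le_rfl).sub
          ((hgrad k k.lt_succ_self).const_smul η)
    refine ⟨hX, ?_⟩
    have hle : k / b * b ≤ k := Nat.div_mul_le_self k b
    have hX0 : Measurable[𝓕 k] (X (k / b * b)) := by
      rcases hle.lt_or_eq with hlt | heq
      · exact (ih _ hlt).1.mono (hP.mono hle) le_rfl
      · rw [heq]; exact hX
    have hJ : ∀ A : Set ℕ, MeasurableSet[𝓕 k] (J k ⁻¹' A) := fun A =>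
      hP.mono hle _ (hP.measurable_index k trivial)
    cases k with
    | zero =>
      have : Z 0 = X (0 / b * b) := funext fun ω => hP.local_zero 0 ω (by
        have := hP.index_le 0 ω
        omega)
      rw [this]
      exact hX0
    | succ k =>
      have hZ : Z (k + 1) = fun ω => if J (k + 1) ω ∈ ({0} : Set ℕ) then X ((k + 1) / b * b) ω
          else Z k ω - localStep b η (J (k + 1) ω - 1) • G (Z k ω) (ξ k ω) := by
        funext ω
        rcases h : J (k + 1) ω with _ | j
        · simp [hP.local_zero _ _ h]
        · simp [(hP.local_succ k j ω h).2.2]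
      rw [hZ]
      refine Measurable.ite (hJ {0}) hX0 ?_
      refine ((ih k k.lt_succ_self).2.mono (hP.mono k.le_succ) le_rfl).sub
        (Measurable.fun_smul ?_ (hgrad k k.lt_succ_self))
      exact (measurable_from_nat (f := fun j => localStep b η (j - 1))).comp
        (fun A _ => hJ A)

/-- If `J` vanishes, `Z` is the round start and every coefficient is `-η`. Otherwise `k` and `J`
grow together, so the window start `k - J` and all earlier coefficients stay the same, and one new
term appears. -/
theorem main_sub_local (hP : IsLocalSGDProcess μ D G w₀ b η 𝓕 X Z ξ J) (k : ℕ) (ω : Ω) :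
    X k ω - Z k ω = ∑ p ∈ Finset.Ico (k / b * b) k,
      driftCoeff b η k (J k ω) p • G (Z p ω) (ξ p ω) := by
  have hround : ∀ s k, s ≤ k →
      X k ω = X s ω - ∑ p ∈ Finset.Ico s k, η • G (Z p ω) (ξ p ω) := by
    intro s k h
    induction k, h using Nat.le_induction with
    | base => simp
    | succ k hk ih => rw [hP.main_succ, ih, Finset.sum_Ico_succ_top hk, sub_sub]
  have hzero : ∀ k, J k ω = 0 → X k ω - Z k ω = ∑ p ∈ Finset.Ico (k / b * b) k,
      driftCoeff b η k (J k ω) p • G (Z p ω) (ξ p ω) := by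
    intro k h
    rw [hP.local_zero k ω h, hround _ k (Nat.div_mul_le_self k b), sub_sub_cancel_left,
      ← Finset.sum_neg_distrib]
    refine Finset.sum_congr rfl fun p hp => ?_
    have : ¬ k - J k ω ≤ p := by
      have := (Finset.mem_Ico.1 hp).2
      omega
    rw [driftCoeff, if_neg this, zero_sub, neg_smul]
  induction k with
  | zero =>
    apply hzero
    have := hP.index_le 0 ω
    omega
  | succ k ih =>
    rcases h : J (k + 1) ω with _ | j
    · rw [← h]
      exact hzero _ h
    · obtain ⟨h1, h2, h3⟩ := hP.local_succ k j ω h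
      have hle := hP.index_le k ω
      rw [h1, Finset.sum_Ico_succ_top (Nat.div_mul_le_self k b), hP.main_succ, h3]
      have h4 : driftCoeff b η (k + 1) (j + 1) k = localStep b η j - η := by
        rw [driftCoeff, if_pos (by omega)]
        congr 2
        omega
      have h5 : ∀ p, driftCoeff b η (k + 1) (j + 1) p = driftCoeff b η k (J k ω) p := by
        intro p
        rw [driftCoeff, driftCoeff, h2, Nat.add_sub_add_right]
      simp_rw [h5] at h4 ⊢
      rw [← ih, h4]
      module

theorem driftCoeff_sq_le (hP : IsLocalSGDProcess μ D G w₀ b η 𝓕 X Z ξ J) (hη : 0 ≤ η) (k : ℕ)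
    (ω : Ω) : ∑ p ∈ Finset.Ico (k / b * b) k, driftCoeff b η k (J k ω) p ^ 2 ≤
      2 * ((b : ℝ) - 1) * η ^ 2 := by
  refine sum_driftCoeff_sq_le hP.pos hη (hP.index_le k ω) ?_
  have := Nat.div_add_mod' k b
  have := Nat.mod_lt k hP.pos
  omega

theorem measurable_driftCoeff (hP : IsLocalSGDProcess μ D G w₀ b η 𝓕 X Z ξ J) {k q : ℕ}
    (hq : k / b * b ≤ q) (p : ℕ) :
    Measurable[𝓕 q] (fun ω => driftCoeff b η k (J k ω) p) :=
  (measurable_from_nat (f := fun j => driftCoeff b η k j p)).comp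
    ((hP.measurable_index k).mono (hP.mono hq) le_rfl)

theorem memLp_driftCoeff_smul (hP : IsLocalSGDProcess μ D G w₀ b η 𝓕 X Z ξ J) (hη : 0 ≤ η)
    {k p : ℕ} (hp : p ∈ Finset.Ico (k / b * b) k) {g : Ω → EuclideanSpace ℝ (Fin d)}
    (hg : MemLp g 2 μ) : MemLp (fun ω => driftCoeff b η k (J k ω) p • g ω) 2 μ := by
  refine hg.of_le_mul (c := √(2 * ((b : ℝ) - 1) * η ^ 2))
    (((hP.measurable_driftCoeff le_rfl p).mono (hP.le _) le_rfl).aestronglyMeasurable.smul hg.1)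
    (ae_of_all _ fun ω => ?_)
  rw [norm_smul]
  refine mul_le_mul_of_nonneg_right (Real.abs_le_sqrt ?_) (norm_nonneg _)
  exact (Finset.single_le_sum (f := fun p => driftCoeff b η k (J k ω) p ^ 2)
    (fun _ _ => sq_nonneg _) hp).trans (hP.driftCoeff_sq_le hη k ω)

variable [IsProbabilityMeasure μ]

theorem integrable_driftCoeff_sq (hP : IsLocalSGDProcess μ D G w₀ b η 𝓕 X Z ξ J) (hη : 0 ≤ η)
    {k p : ℕ} (hp : p ∈ Finset.Ico (k / b * b) k) :
    Integrable (fun ω => driftCoeff b η k (J k ω) p ^ 2) μ := by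
  refine (integrable_const (2 * ((b : ℝ) - 1) * η ^ 2)).mono' ?_ (ae_of_all _ fun ω => ?_)
  · exact (((hP.measurable_driftCoeff le_rfl p).mono (hP.le _) le_rfl).pow_const
      2).aestronglyMeasurable
  · rw [Real.norm_of_nonneg (sq_nonneg _)]
    exact (Finset.single_le_sum (f := fun p => driftCoeff b η k (J k ω) p ^ 2)
      (fun _ _ => sq_nonneg _) hp).trans (hP.driftCoeff_sq_le hη k ω)

/-! ### Second moments, drift and descent in expectation -/

variable [IsProbabilityMeasure D]

theorem memLp_noise (hP : IsLocalSGDProcess μ D G w₀ b η 𝓕 X Z ξ J) (hf : IsSmooth f L)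
    (hG : IsStochasticGradient f G D σ) (k : ℕ) :
    MemLp (fun ω => G (Z k ω) (ξ k ω) - gradient f (Z k ω)) 2 μ ∧
      ∫ ω, ‖G (Z k ω) (ξ k ω) - gradient f (Z k ω)‖ ^ 2 ∂μ ≤ σ ^ 2 := by
  simpa using memLp_smul_noise hf hG (hP.le k) (hP.measurable_sample' k) (hP.law k) (hP.indep k)
    (hP.measurable_points hG k).2 (c := fun _ => 1) measurable_const (by simp)

theorem integral_inner_noise (hP : IsLocalSGDProcess μ D G w₀ b η 𝓕 X Z ξ J) (hf : IsSmooth f L)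
    (hG : IsStochasticGradient f G D σ) (k : ℕ) {U : Ω → EuclideanSpace ℝ (Fin d)}
    (hU : Measurable[𝓕 k] U) (hU2 : MemLp U 2 μ) :
    ∫ ω, inner ℝ (U ω) (G (Z k ω) (ξ k ω) - gradient f (Z k ω)) ∂μ = 0 :=
  BirchSGD.integral_inner_noise hf hG (hP.le k) (hP.measurable_sample' k) (hP.law k) (hP.indep k)
    (hP.measurable_points hG k).2 hU (integrable_inner_of_memLp hU2 (hP.memLp_noise hf hG k).1)

theorem memLp_points (hP : IsLocalSGDProcess μ D G w₀ b η 𝓕 X Z ξ J) (hf : IsSmooth f L)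
    (hG : IsStochasticGradient f G D σ) (hη : 0 ≤ η) (k : ℕ) :
    MemLp (X k) 2 μ ∧ MemLp (Z k) 2 μ := by
  induction k using Nat.strong_induction_on with
  | _ k ih =>
    have hgrad : ∀ i < k, MemLp (fun ω => G (Z i ω) (ξ i ω)) 2 μ := fun i hi =>
      ((hP.memLp_noise hf hG i).1.add (memLp_gradient hf (ih i hi).2)).ae_eq
        (ae_of_all _ fun ω => by simp)
    have hX : MemLp (X k) 2 μ := by
      cases k with
      | zero =>
        rw [show X 0 = fun _ => w₀ from funext hP.main_zero]
        exact memLp_const _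
      | succ k =>
        rw [show X (k + 1) = fun ω => X k ω - η • G (Z k ω) (ξ k ω) from
          funext (hP.main_succ k)]
        exact (ih k k.lt_succ_self).1.sub ((hgrad k k.lt_succ_self).const_smul η)
    refine ⟨hX, ?_⟩
    -- Expressing `Z k` through the drift involves only earlier gradients with bounded coefficients.
    have hZ : Z k = fun ω => X k ω - ∑ p ∈ Finset.Ico (k / b * b) k,
        driftCoeff b η k (J k ω) p • G (Z p ω) (ξ p ω) := by
      funext ω
      rw [← hP.main_sub_local, sub_sub_cancel]
    rw [hZ]
    exact hX.sub (memLp_finsetSum _ fun p hp =>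
      hP.memLp_driftCoeff_smul hη hp (hgrad p (Finset.mem_Ico.1 hp).2))

/-- The random coefficients are known at the start of the round, so the terms are martingale
differences. The upper end `q` is separated from `k` to allow induction while the coefficients stay
those of `k`. -/
theorem integral_sq_sum_noise_le (hP : IsLocalSGDProcess μ D G w₀ b η 𝓕 X Z ξ J)
    (hf : IsSmooth f L) (hG : IsStochasticGradient f G D σ) (hη : 0 ≤ η) {k q : ℕ}
    (hq : k / b * b ≤ q) (hqk : q ≤ k) :
    ∫ ω, ‖∑ p ∈ Finset.Ico (k / b * b) q,
        driftCoeff b η k (J k ω) p • (G (Z p ω) (ξ p ω) - gradient f (Z p ω))‖ ^ 2 ∂μ ≤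
      σ ^ 2 * ∑ p ∈ Finset.Ico (k / b * b) q, ∫ ω, driftCoeff b η k (J k ω) p ^ 2 ∂μ := by
  induction q, hq using Nat.le_induction with
  | base => simp
  | succ q hq ih =>
    have hmem : ∀ p ∈ Finset.Ico (k / b * b) (q + 1), p ∈ Finset.Ico (k / b * b) k :=
      fun p hp => Finset.Ico_subset_Ico le_rfl hqk hp
    have hqmem : q ∈ Finset.Ico (k / b * b) (q + 1) := Finset.mem_Ico.2 ⟨hq, q.lt_succ_self⟩
    set U : Ω → EuclideanSpace ℝ (Fin d) := fun ω => ∑ p ∈ Finset.Ico (k / b * b) q,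
      driftCoeff b η k (J k ω) p • (G (Z p ω) (ξ p ω) - gradient f (Z p ω)) with hU
    set N : Ω → EuclideanSpace ℝ (Fin d) := fun ω => G (Z q ω) (ξ q ω) - gradient f (Z q ω) with hN
    set c : Ω → ℝ := fun ω => driftCoeff b η k (J k ω) q with hc
    have hUm : Measurable[𝓕 q] U := by
      refine Finset.measurable_fun_sum _ fun p hp => ?_
      have hpq := (Finset.mem_Ico.1 hp).2
      exact (hP.measurable_driftCoeff hq p).fun_smul ((measurable_noise hf hG).comp
        (((hP.measurable_points hG p).2.mono (hP.mono hpq.le) le_rfl).prodMk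
          ((hP.measurable_sample p).mono (hP.mono hpq) le_rfl)))
    have hU2 : MemLp U 2 μ := memLp_finsetSum _ fun p hp =>
      hP.memLp_driftCoeff_smul hη (hmem p (Finset.Ico_subset_Ico le_rfl q.le_succ hp))
        (hP.memLp_noise hf hG p).1
    have hcN := memLp_smul_noise hf hG (hP.le q) (hP.measurable_sample' q) (hP.law q) (hP.indep q)
      (hP.measurable_points hG q).2 (hP.measurable_driftCoeff hq q)
      (hP.integrable_driftCoeff_sq hη (hmem q hqmem))
    have hcross : ∫ ω, inner ℝ (U ω) (c ω • N ω) ∂μ = 0 := by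
      -- The coefficient is moved onto the past factor, which stays `𝓕 q`-measurable.
      have h1 := hP.integral_inner_noise hf hG q (U := fun ω => c ω • U ω)
        ((hP.measurable_driftCoeff hq q).fun_smul hUm)
        (hP.memLp_driftCoeff_smul hη (hmem q hqmem) hU2)
      rw [← h1]
      exact integral_congr_ae (ae_of_all _ fun ω => by
        simp only [real_inner_smul_left, real_inner_smul_right, hN])
    have hsplit : ∀ ω, ‖∑ p ∈ Finset.Ico (k / b * b) (q + 1),
        driftCoeff b η k (J k ω) p • (G (Z p ω) (ξ p ω) - gradient f (Z p ω))‖ ^ 2 =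
        ‖U ω‖ ^ 2 + 2 * inner ℝ (U ω) (c ω • N ω) + ‖c ω • N ω‖ ^ 2 := by
      intro ω
      rw [Finset.sum_Ico_succ_top hq, norm_add_sq_real]
    have i1 : Integrable (fun ω => ‖U ω‖ ^ 2) μ := hU2.integrable_norm_pow (by norm_num)
    have i2 : Integrable (fun ω => 2 * inner ℝ (U ω) (c ω • N ω)) μ :=
      (integrable_inner_of_memLp hU2 hcN.1).const_mul 2
    have i3 : Integrable (fun ω => ‖c ω • N ω‖ ^ 2) μ := hcN.1.integrable_norm_pow (by norm_num)
    simp_rw [hsplit]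
    rw [integral_add (i1.fun_add i2) i3, integral_add i1 i2, integral_const_mul, hcross, mul_zero,
      add_zero, Finset.sum_Ico_succ_top hq, mul_add]
    exact add_le_add (ih (Nat.le_of_succ_le hqk)) hcN.2

theorem integral_sq_main_sub_local_le (hP : IsLocalSGDProcess μ D G w₀ b η 𝓕 X Z ξ J)
    (hf : IsSmooth f L) (hG : IsStochasticGradient f G D σ) (hη : 0 ≤ η) (k : ℕ) :
    ∫ ω, ‖X k ω - Z k ω‖ ^ 2 ∂μ ≤ 4 * ((b : ℝ) - 1) * η ^ 2 *
      (∑ p ∈ Finset.Ico (k / b * b) k, ∫ ω, ‖gradient f (Z p ω)‖ ^ 2 ∂μ + σ ^ 2) := by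
  set I := Finset.Ico (k / b * b) k with hI
  set B : Ω → EuclideanSpace ℝ (Fin d) := fun ω => ∑ p ∈ I,
    driftCoeff b η k (J k ω) p • (G (Z p ω) (ξ p ω) - gradient f (Z p ω)) with hB
  have hgrad : ∀ p, Integrable (fun ω => ‖gradient f (Z p ω)‖ ^ 2) μ := fun p =>
    (memLp_gradient hf (hP.memLp_points hf hG hη p).2).integrable_norm_pow (by norm_num)
  have hB2 : Integrable (fun ω => ‖B ω‖ ^ 2) μ :=
    (memLp_finsetSum _ fun p hp =>
      hP.memLp_driftCoeff_smul hη hp (hP.memLp_noise hf hG p).1).integrable_norm_pow (by norm_num)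
  have hpath : ∀ ω, ‖X k ω - Z k ω‖ ^ 2 ≤
      2 * (2 * ((b : ℝ) - 1) * η ^ 2) * ∑ p ∈ I, ‖gradient f (Z p ω)‖ ^ 2 + 2 * ‖B ω‖ ^ 2 := by
    intro ω
    set A := ∑ p ∈ I, driftCoeff b η k (J k ω) p • gradient f (Z p ω) with hA
    have h1 : X k ω - Z k ω = A + B ω := by
      rw [hP.main_sub_local, hA, hB, ← Finset.sum_add_distrib]
      exact Finset.sum_congr rfl fun p _ => by rw [← smul_add, add_sub_cancel]
    have h2 : ‖A‖ ≤ ∑ p ∈ I, |driftCoeff b η k (J k ω) p| * ‖gradient f (Z p ω)‖ := by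
      refine (norm_sum_le _ _).trans_eq (Finset.sum_congr rfl fun p _ => ?_)
      rw [norm_smul, Real.norm_eq_abs]
    have h3 : ‖A‖ ^ 2 ≤ (2 * ((b : ℝ) - 1) * η ^ 2) * ∑ p ∈ I, ‖gradient f (Z p ω)‖ ^ 2 := by
      refine (pow_le_pow_left₀ (norm_nonneg _) h2 2).trans
        ((Finset.sum_mul_sq_le_sq_mul_sq _ _ _).trans ?_)
      simp_rw [sq_abs]
      exact mul_le_mul_of_nonneg_right (hP.driftCoeff_sq_le hη k ω)
        (Finset.sum_nonneg fun _ _ => sq_nonneg _)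
    have h4 := norm_add_le A (B ω)
    rw [h1]
    nlinarith [sq_nonneg (‖A‖ - ‖B ω‖), norm_nonneg (A + B ω)]
  have hBle : ∫ ω, ‖B ω‖ ^ 2 ∂μ ≤ σ ^ 2 * (2 * ((b : ℝ) - 1) * η ^ 2) := by
    refine (hP.integral_sq_sum_noise_le hf hG hη (Nat.div_mul_le_self k b) le_rfl).trans
      (mul_le_mul_of_nonneg_left ?_ (sq_nonneg σ))
    rw [← integral_finsetSum _ fun p hp => hP.integrable_driftCoeff_sq hη hp]
    refine (integral_mono (integrable_finsetSum _ fun p hp =>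
      hP.integrable_driftCoeff_sq hη hp) (integrable_const _)
      (fun ω => hP.driftCoeff_sq_le hη k ω)).trans_eq ?_
    simp
  have hsum : Integrable (fun ω => ∑ p ∈ I, ‖gradient f (Z p ω)‖ ^ 2) μ :=
    integrable_finsetSum _ fun p _ => hgrad p
  calc ∫ ω, ‖X k ω - Z k ω‖ ^ 2 ∂μ
      ≤ ∫ ω, (2 * (2 * ((b : ℝ) - 1) * η ^ 2) * ∑ p ∈ I, ‖gradient f (Z p ω)‖ ^ 2 +
          2 * ‖B ω‖ ^ 2) ∂μ := by
        refine integral_mono_of_nonneg (ae_of_all _ fun _ => sq_nonneg _)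
          ((hsum.const_mul _).add (hB2.const_mul 2)) (ae_of_all _ hpath)
    _ = 2 * (2 * ((b : ℝ) - 1) * η ^ 2) * ∑ p ∈ I, ∫ ω, ‖gradient f (Z p ω)‖ ^ 2 ∂μ +
          2 * ∫ ω, ‖B ω‖ ^ 2 ∂μ := by
        rw [integral_add (hsum.const_mul _) (hB2.const_mul 2), integral_const_mul,
          integral_const_mul, integral_finsetSum _ fun p _ => hgrad p]
    _ ≤ _ := by linarith

theorem integral_descent (hP : IsLocalSGDProcess μ D G w₀ b η 𝓕 X Z ξ J)
    (hf : IsSmooth f L) (hG : IsStochasticGradient f G D σ) (hη : 0 ≤ η) (hL : 0 ≤ L)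
    (hbdd : BddBelow (Set.range f)) (k : ℕ) (hfk : Integrable (fun ω => f (X k ω)) μ) :
    Integrable (fun ω => f (X (k + 1) ω)) μ ∧
    ∫ ω, f (X (k + 1) ω) ∂μ +
        η * ((∫ ω, ‖gradient f (X k ω)‖ ^ 2 ∂μ) / 2 +
          (1 - L * η) / 2 * ∫ ω, ‖gradient f (Z k ω)‖ ^ 2 ∂μ -
          (∫ ω, ‖gradient f (X k ω) - gradient f (Z k ω)‖ ^ 2 ∂μ) / 2) ≤
      ∫ ω, f (X k ω) ∂μ + L * η ^ 2 / 2 * σ ^ 2 := by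
  have hpts := hP.memLp_points hf hG hη
  have hN := hP.memLp_noise hf hG k
  have ha := memLp_gradient hf (hpts k).1
  have hc := memLp_gradient hf (hpts k).2
  have hcm : Continuous (gradient f) := hf.continuous_gradient
  have hmeas := hP.measurable_points hG k
  have ham : Measurable[𝓕 k] (fun ω => gradient f (X k ω)) := hcm.measurable.comp hmeas.1
  have hcm' : Measurable[𝓕 k] (fun ω => gradient f (Z k ω)) := hcm.measurable.comp hmeas.2
  have z1 := hP.integral_inner_noise hf hG k ham ha
  have z2 := hP.integral_inner_noise hf hG k hcm' hc
  set a : Ω → EuclideanSpace ℝ (Fin d) := fun ω => gradient f (X k ω) with ha_def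
  set c : Ω → EuclideanSpace ℝ (Fin d) := fun ω => gradient f (Z k ω) with hc_def
  set N : Ω → EuclideanSpace ℝ (Fin d) := fun ω => G (Z k ω) (ξ k ω) - gradient f (Z k ω)
    with hN_def
  have j1 : Integrable (fun ω => inner ℝ (a ω) (N ω)) μ := integrable_inner_of_memLp ha hN.1
  have j2 : Integrable (fun ω => inner ℝ (c ω) (N ω)) μ := integrable_inner_of_memLp hc hN.1
  have j3 : Integrable (fun ω => ‖a ω‖ ^ 2) μ := ha.integrable_norm_pow (by norm_num)
  have j4 : Integrable (fun ω => ‖c ω‖ ^ 2) μ := hc.integrable_norm_pow (by norm_num)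
  have j5 : Integrable (fun ω => ‖a ω - c ω‖ ^ 2) μ := (ha.sub hc).integrable_norm_pow (by norm_num)
  have j6 : Integrable (fun ω => ‖N ω‖ ^ 2) μ := hN.1.integrable_norm_pow (by norm_num)
  set F : Ω → ℝ := fun ω => f (X k ω) + (-(η / 2)) * ‖a ω‖ ^ 2 +
    (-(η * (1 - L * η) / 2)) * ‖c ω‖ ^ 2 + η / 2 * ‖a ω - c ω‖ ^ 2 +
    (-η) * inner ℝ (a ω) (N ω) + L * η ^ 2 * inner ℝ (c ω) (N ω) +
    L * η ^ 2 / 2 * ‖N ω‖ ^ 2 with hF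
  have i1 := hfk.fun_add (j3.const_mul (-(η / 2)))
  have i2 := i1.fun_add (j4.const_mul (-(η * (1 - L * η) / 2)))
  have i3 := i2.fun_add (j5.const_mul (η / 2))
  have i4 := i3.fun_add (j1.const_mul (-η))
  have i5 := i4.fun_add (j2.const_mul (L * η ^ 2))
  have i6 := i5.fun_add (j6.const_mul (L * η ^ 2 / 2))
  have hFint : Integrable F μ := i6
  have hFval : ∫ ω, F ω ∂μ = ∫ ω, f (X k ω) ∂μ + (-(η / 2)) * ∫ ω, ‖a ω‖ ^ 2 ∂μ +
      (-(η * (1 - L * η) / 2)) * ∫ ω, ‖c ω‖ ^ 2 ∂μ + η / 2 * ∫ ω, ‖a ω - c ω‖ ^ 2 ∂μ +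
      L * η ^ 2 / 2 * ∫ ω, ‖N ω‖ ^ 2 ∂μ := by
    simp only [hF]
    rw [integral_add i5 (j6.const_mul _), integral_add i4 (j2.const_mul _),
      integral_add i3 (j1.const_mul _), integral_add i2 (j5.const_mul _),
      integral_add i1 (j4.const_mul _), integral_add hfk (j3.const_mul _)]
    simp only [integral_const_mul]
    have z1' : ∫ ω, inner ℝ (a ω) (N ω) ∂μ = 0 := z1
    have z2' : ∫ ω, inner ℝ (c ω) (N ω) ∂μ = 0 := z2
    rw [z1', z2']
    ring
  have hle : ∀ ω, f (X (k + 1) ω) ≤ F ω := by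
    intro ω
    have h1 := hf.le_add_inner_add_sq (X k ω) (X (k + 1) ω)
    have h2 : X (k + 1) ω - X k ω = -(η • (c ω + N ω)) := by
      rw [hP.main_succ, hc_def, hN_def, sub_sub_cancel_left, add_sub_cancel]
    rw [h2, norm_neg, norm_smul, mul_pow, Real.norm_eq_abs, sq_abs, inner_neg_right,
      real_inner_smul_right, inner_add_right, norm_add_sq_real] at h1
    have h3 := norm_sub_sq_real (a ω) (c ω)
    have h4 : inner ℝ (a ω) (c ω) = (‖a ω‖ ^ 2 + ‖c ω‖ ^ 2 - ‖a ω - c ω‖ ^ 2) / 2 := by linarith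
    have h5 : inner ℝ (gradient f (X k ω)) (c ω) = inner ℝ (a ω) (c ω) := rfl
    rw [h5, h4] at h1
    refine h1.trans_eq ?_
    simp only [hF]
    ring
  obtain ⟨m, hm⟩ := hbdd
  -- Integrability comes from squeezing between the lower bound of `f` and the integrable majorant
  -- `F`.
  have hint : Integrable (fun ω => f (X (k + 1) ω)) μ := by
    refine integrable_of_le_of_le (g₁ := fun _ => m) (g₂ := F) ?_
      (ae_of_all _ fun ω => hm ⟨_, rfl⟩) (ae_of_all _ hle) (integrable_const m) hFint
    exact hf.differentiable.continuous.comp_aestronglyMeasurable (hpts (k + 1)).1.1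
  refine ⟨hint, ?_⟩
  have h1 := integral_mono hint hFint hle
  rw [hFval] at h1
  have h2 := mul_le_mul_of_nonneg_left hN.2 (show 0 ≤ L * η ^ 2 / 2 by positivity)
  linarith

theorem integral_sum_descent (hP : IsLocalSGDProcess μ D G w₀ b η 𝓕 X Z ξ J)
    (hf : IsSmooth f L) (hG : IsStochasticGradient f G D σ) (hη : 0 ≤ η) (hL : 0 ≤ L)
    (hbdd : BddBelow (Set.range f)) (K : ℕ) :
    Integrable (fun ω => f (X K ω)) μ ∧
    ∫ ω, f (X K ω) ∂μ +
        η * ((∑ k ∈ Finset.range K, ∫ ω, ‖gradient f (X k ω)‖ ^ 2 ∂μ) / 2 +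
          (1 - L * η) / 2 * ∑ k ∈ Finset.range K, ∫ ω, ‖gradient f (Z k ω)‖ ^ 2 ∂μ -
          (∑ k ∈ Finset.range K,
            ∫ ω, ‖gradient f (X k ω) - gradient f (Z k ω)‖ ^ 2 ∂μ) / 2) ≤
      f w₀ + K * (L * η ^ 2 / 2 * σ ^ 2) := by
  induction K with
  | zero => simp [hP.main_zero]
  | succ K ih =>
    obtain ⟨h1, h2⟩ := hP.integral_descent hf hG hη hL hbdd K ih.1
    refine ⟨h1, ?_⟩
    simp only [Finset.sum_range_succ]
    push_cast
    linarith [ih.2]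

theorem sum_integral_sq_gradient_le {ε : ℝ} (hP : IsLocalSGDProcess μ D G w₀ b η 𝓕 X Z ξ J)
    (hf : IsSmooth f L) (hG : IsStochasticGradient f G D σ) (hL : 0 < L) (hσ : 0 ≤ σ)
    (hε : 0 < ε) (hbdd : BddBelow (Set.range f)) (hη : η = globalStep b L σ ε) {K : ℕ}
    (hK : 8 * b * L * (f w₀ - ⨅ y, f y) / ε + 16 * σ ^ 2 * L * (f w₀ - ⨅ y, f y) / ε ^ 2 ≤ K) :
    ∑ k ∈ Finset.range K, ∫ ω, ‖gradient f (X k ω)‖ ^ 2 ∂μ ≤ ε * K := by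
  have hη0 : 0 ≤ η := hη ▸ (globalStep_pos hP.pos hL hσ hε).le
  have hb1 : (0 : ℝ) ≤ (b : ℝ) - 1 := sub_nonneg.2 (Nat.one_le_cast.2 hP.pos)
  have hpts := hP.memLp_points hf hG hη0
  have ha : ∀ k, MemLp (fun ω => gradient f (X k ω)) 2 μ := fun k => memLp_gradient hf (hpts k).1
  have hc : ∀ k, MemLp (fun ω => gradient f (Z k ω)) 2 μ := fun k => memLp_gradient hf (hpts k).2
  have hc2 : ∀ k, 0 ≤ ∫ ω, ‖gradient f (Z k ω)‖ ^ 2 ∂μ := fun k =>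
    integral_nonneg fun _ => sq_nonneg _
  obtain ⟨hint, hdesc⟩ := hP.integral_sum_descent hf hG hη0 hL.le hbdd K
  have hinf : ⨅ y, f y ≤ ∫ ω, f (X K ω) ∂μ := by
    have := integral_mono (integrable_const (⨅ y, f y)) hint (fun ω => ciInf_le hbdd (X K ω))
    simpa using this
  refine sum_sq_le_of_descent (b := b) (C := ∑ k ∈ Finset.range K,
      ∫ ω, ‖gradient f (Z k ω)‖ ^ 2 ∂μ) (Q := ∑ k ∈ Finset.range K,
      ∫ ω, ‖gradient f (X k ω) - gradient f (Z k ω)‖ ^ 2 ∂μ) hP.pos hL hσ hε hη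
    (Finset.sum_nonneg fun k _ => hc2 k) K.cast_nonneg (sub_nonneg.2 (ciInf_le hbdd w₀)) hK
    (by linarith) ?_ ?_
  · have h1 : ∀ k, ∫ ω, ‖gradient f (X k ω) - gradient f (Z k ω)‖ ^ 2 ∂μ ≤
        4 * ((b : ℝ) - 1) * η ^ 2 * L ^ 2 *
          (∑ p ∈ Finset.Ico (k / b * b) k, ∫ ω, ‖gradient f (Z p ω)‖ ^ 2 ∂μ + σ ^ 2) := by
      intro k
      have hint : Integrable (fun ω => ‖X k ω - Z k ω‖ ^ 2) μ :=
        ((hpts k).1.sub (hpts k).2).integrable_norm_pow (by norm_num)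
      have h2 : ∫ ω, ‖gradient f (X k ω) - gradient f (Z k ω)‖ ^ 2 ∂μ ≤
          ∫ ω, L ^ 2 * ‖X k ω - Z k ω‖ ^ 2 ∂μ :=
        integral_mono_of_nonneg (ae_of_all _ fun _ => sq_nonneg _) (hint.const_mul _)
          (ae_of_all _ fun ω => by
            simpa only [mul_pow] using
              pow_le_pow_left₀ (norm_nonneg _) (hf.lipschitz (X k ω) (Z k ω)) 2)
      rw [integral_const_mul] at h2
      have h3 := mul_le_mul_of_nonneg_left (hP.integral_sq_main_sub_local_le hf hG hη0 k)
        (sq_nonneg L)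
      linarith
    refine (Finset.sum_le_sum fun k _ => h1 k).trans ?_
    rw [← Finset.mul_sum, Finset.sum_add_distrib, Finset.sum_const, Finset.card_range,
      nsmul_eq_mul]
    have := sum_sum_Ico_round_le hP.pos _ hc2 K
    gcongr
  · rw [Finset.mul_sum, Finset.mul_sum, ← Finset.sum_add_distrib]
    refine Finset.sum_le_sum fun k _ => ?_
    have i1 : Integrable (fun ω => ‖gradient f (Z k ω)‖ ^ 2) μ :=
      (hc k).integrable_norm_pow (by norm_num)
    have i2 : Integrable (fun ω => ‖gradient f (X k ω) - gradient f (Z k ω)‖ ^ 2) μ :=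
      ((ha k).sub (hc k)).integrable_norm_pow (by norm_num)
    rw [← integral_const_mul, ← integral_const_mul,
      ← integral_add (i1.const_mul 2) (i2.const_mul 2)]
    refine integral_mono ((ha k).integrable_norm_pow (by norm_num))
      ((i1.const_mul 2).add (i2.const_mul 2)) fun ω => ?_
    have h := norm_add_le (gradient f (Z k ω)) (gradient f (X k ω) - gradient f (Z k ω))
    rw [add_sub_cancel] at h
    nlinarith [sq_nonneg (‖gradient f (Z k ω)‖ - ‖gradient f (X k ω) - gradient f (Z k ω)‖),
      norm_nonneg (gradient f (X k ω))]

end IsLocalSGDProcess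

/-! ### The method as a process -/

section Filtration

variable {d n b : ℕ} {Ω S : Type*} [MeasurableSpace S] {M : Ω → Schedule n b}
  {ζ : ℕ × Fin n × ℕ → Ω → S}

theorem measurable_pi_of_forall {m : MeasurableSpace Ω} {ι : Type*} {α : ι → Type*}
    [∀ i, MeasurableSpace (α i)] {g : Ω → ∀ i, α i} (hg : ∀ i, Measurable (fun ω => g ω i)) :
    Measurable g :=
  measurable_pi_lambda g hg

/-- The events determined by the numbers of local steps up to the current round and by the samples
used before. -/
@[reducible]
def pastEvents (M : Ω → Schedule n b) (ζ : ℕ × Fin n × ℕ → Ω → S) (k : ℕ) : MeasurableSpace Ω :=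
  MeasurableSpace.comap (pastData M ζ k) inferInstance

theorem measurable_steps_pastEvents {k r : ℕ} (hr : r ≤ k / b) (i : Fin n) :
    Measurable[pastEvents M ζ k] (fun ω => (M ω).steps r i) :=
  (show Measurable (fun p : (Fin (k / b + 1) → Fin n → ℕ) × (Fin k → S) =>
    p.1 ⟨r, Nat.lt_succ_of_le hr⟩ i) by fun_prop).comp (comap_measurable (pastData M ζ k))

theorem measurable_usedSample_pastEvents {k i : ℕ} (hi : i < k) :
    Measurable[pastEvents M ζ k] (usedSample M ζ i) :=
  (show Measurable (fun p : (Fin (k / b + 1) → Fin n → ℕ) × (Fin k → S) => p.2 ⟨i, hi⟩) by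
    fun_prop).comp (comap_measurable (pastData M ζ k))

theorem pastEvents_mono : Monotone (pastEvents M ζ) := by
  intro k k' h
  refine Measurable.comap_le (Measurable.prodMk ?_ ?_)
  · exact measurable_pi_of_forall fun r => measurable_pi_of_forall fun i =>
      measurable_steps_pastEvents
        ((Nat.le_of_lt_succ r.2).trans (Nat.div_le_div_right h)) i
  · exact measurable_pi_of_forall fun i => measurable_usedSample_pastEvents (i.2.trans_le h)

variable [mΩ : MeasurableSpace Ω] {μ : Measure Ω} {D : Measure S}

theorem isLocalSGDProcess_decayingTree [IsProbabilityMeasure μ]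
    {G : EuclideanSpace ℝ (Fin d) → S → EuclideanSpace ℝ (Fin d)} {w₀ : EuclideanSpace ℝ (Fin d)}
    (η : ℝ) (hb : 0 < b) (hM : ∀ r i, Measurable (fun ω => (M ω).steps r i))
    (hζ : ∀ a, Measurable (ζ a)) (hlaw : ∀ a, μ.map (ζ a) = D) (hindep : iIndepFun ζ μ)
    (hMζ : ∀ r : ℕ, IndepFun
      (fun ω (a : Fin n × ℕ) => ζ (r, a) ω)
      (fun ω => ((fun (s : Fin (r + 1)) (i : Fin n) => (M ω).steps s i),
        (fun (a : Fin r × Fin n × ℕ) => ζ ((a.1 : ℕ), a.2) ω))) μ) :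
    IsLocalSGDProcess μ D G w₀ b η (pastEvents M ζ)
      (fun k ω => (decayingTree (M ω) η).point w₀ G (fun a => ζ a ω) (2 * k))
      (fun k ω => (decayingTree (M ω) η).point w₀ G (fun a => ζ a ω) ((M ω).gradNode k))
      (usedSample M ζ) (fun k ω => ((M ω).sample k).2.2) where
  pos := hb
  le k := (measurable_pastData hM hζ k).comap_le
  mono := pastEvents_mono
  indep k := by
    have := (map_usedSample_and_indepFun hM hζ hlaw hindep hMζ k).2
    rwa [IndepFun_iff_Indep] at this
  law k := (map_usedSample_and_indepFun hM hζ hlaw hindep hMζ k).1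
  measurable_sample k := measurable_usedSample_pastEvents k.lt_succ_self
  measurable_index k := by
    refine measurable_of_factorsThrough (g := fun ω => (M ω).steps (k / b))
      (measurable_pi_of_forall fun i => measurable_steps_pastEvents ?_ i) (fun ω ω' h => ?_)
    · rw [Nat.mul_div_cancel _ hb]
    · exact congrArg (fun a => a.2.2) (Schedule.sample_congr h)
  index_le k ω := (M ω).round_mul_add_localIndex_le k
  main_zero ω := by simp [ComputationTree.point]
  main_succ k ω := decayingTree_point_two_mul_succ (M ω) η w₀ G _ k
  local_zero k ω h := by simp only [(M ω).gradNode_of_zero h]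
  local_succ k j ω h := by
    refine ⟨(M ω).div_of_localIndex_succ h, (M ω).localIndex_of_succ h, ?_⟩
    simp only [(M ω).gradNode_of_succ h]
    rw [decayingTree_point_two_mul_add_one, (M ω).localIndex_of_succ h]
    rfl

theorem mainConditions_decayingTree [IsProbabilityMeasure μ] {L σ ε η : ℝ}
    {f : EuclideanSpace ℝ (Fin d) → ℝ}
    {G : EuclideanSpace ℝ (Fin d) → S → EuclideanSpace ℝ (Fin d)} {w₀ : EuclideanSpace ℝ (Fin d)}
    (hG : IsStochasticGradient f G D σ) (hb : 0 < b) (hL : 0 < L) (hσ : 0 ≤ σ) (hε : 0 < ε)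
    (hη : η = globalStep b L σ ε)
    (hP : IsLocalSGDProcess μ D G w₀ b η (pastEvents M ζ)
      (fun k ω => (decayingTree (M ω) η).point w₀ G (fun a => ζ a ω) (2 * k))
      (fun k ω => (decayingTree (M ω) η).point w₀ G (fun a => ζ a ω) ((M ω).gradNode k))
      (usedSample M ζ) (fun k ω => ((M ω).sample k).2.2)) :
    MainConditions μ D w₀ G ζ (fun ω => decayingTree (M ω) η)
      (fun _ k => 2 * k) (fun _ _ => η) (fun ω k => (M ω).gradNode k)
      (fun ω k => (M ω).sample k) L σ ε ((b : ℝ) - 1) η where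
  branch ω := decayingTree_isMainBranch (M ω) η (hη ▸ globalStep_pos hb hL hσ hε)
  law k := ⟨hP.measurable_sample' k, hP.law k⟩
  indep k := by
    rw [IndepFun_iff_Indep]
    refine indep_of_indep_of_le_right (hP.indep k) (Measurable.comap_le ?_)
    refine measurable_pi_of_forall fun i => ?_
    have hi : (i : ℕ) + 1 ≤ k := i.2
    have h := hP.measurable_points hG (i + 1)
    exact (h.1.mono (hP.mono hi) le_rfl).prodMk ((h.2.mono (hP.mono hi) le_rfl).prodMk
      (measurable_usedSample_pastEvents i.2))
  repr_le ω k := decayingTree_repr_gradNode_le (M ω) η k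
  dist_le ω k := by
    rw [← Nat.cast_one, ← Nat.cast_sub hb]
    exact Nat.cast_le.2 (decayingTree_dist_le (M ω) η k)
  step_eq _ _ := rfl
  step_le := by
    have h1 := hη ▸ globalStep_le (σ := σ) (ε := ε) hb hL
    have h2 : (1 : ℝ) ≤ b := Nat.one_le_cast.2 hb
    have h3 : 0 < L * η := mul_pos hL (hη ▸ globalStep_pos hb hL hσ hε)
    have h4 := mul_le_mul_of_nonneg_right h2 h3.le
    refine ⟨by linarith, by linarith, hη ▸ sq_mul_globalStep_le hL hσ hε⟩
  other_step_le ω e he := by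
    have hη0 : 0 ≤ η := hη ▸ (globalStep_pos hb hL hσ hε).le
    obtain ⟨k, rfl | rfl⟩ := e.even_or_odd'
    · rw [decayingTree_step_two_mul, decayingTree_base_two_mul]
      refine ⟨localStep_nonneg hη0 _, mul_le_mul_of_nonneg_right (Real.sqrt_le_sqrt ?_) hη0⟩
      have h1 : (0 : ℝ) ≤ (b : ℝ) - 1 := sub_nonneg.2 (Nat.one_le_cast.2 hb)
      have h2 := log_sub_one_nonneg hb
      have h3 : (((decayingTree (M ω) η).distBranch ((M ω).gradNode k) (fun k => 2 * k) : ℕ) : ℝ) ≤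
          (((M ω).sample k).2.2 : ℕ) := Nat.cast_le.2 (decayingTree_distBranch_le (M ω) η k)
      -- The bound decreases with the distance to the main branch, and this distance is at most the
      -- local index.
      gcongr
    · exact absurd rfl (he k)

end Filtration

end BirchSGD

/-- Convergence of asynchronous Decaying Local SGD. The numbers of local steps may be random and may
depend on the past: the samples of a round are only required to be independent of the numbers of
local steps up to that round and of the earlier samples. -/
theorem mainTheorem12
    {d n b : ℕ} {Ω S : Type*} [MeasurableSpace Ω] [MeasurableSpace S]
    (μ : Measure Ω) [IsProbabilityMeasure μ] (D : Measure S) [IsProbabilityMeasure D]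
    (f : EuclideanSpace ℝ (Fin d) → ℝ)
    (G : EuclideanSpace ℝ (Fin d) → S → EuclideanSpace ℝ (Fin d))
    (w₀ : EuclideanSpace ℝ (Fin d)) (L σ ε : ℝ)
    (hL : 0 < L) (hσ : 0 ≤ σ) (hε : 0 < ε)
    (hf : IsSmooth f L) (hbdd : BddBelow (Set.range f))
    (hG : IsStochasticGradient f G D σ)
    (M : Ω → Schedule n b) (hM : ∀ r i, Measurable (fun ω => (M ω).steps r i))
    (ζ : ℕ × Fin n × ℕ → Ω → S) (hζ : ∀ a, Measurable (ζ a))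
    (hlaw : ∀ a, μ.map (ζ a) = D) (hindep : iIndepFun ζ μ)
    (hMζ : ∀ r : ℕ, IndepFun
      (fun ω (a : Fin n × ℕ) => ζ (r, a) ω)
      (fun ω => ((fun (s : Fin (r + 1)) (i : Fin n) => (M ω).steps s i),
        (fun (a : Fin r × Fin n × ℕ) => ζ ((a.1 : ℕ), a.2) ω))) μ)
    (η : ℝ) (hη : η = globalStep b L σ ε)
    (x : ℕ → Ω → EuclideanSpace ℝ (Fin d))
    (hx : ∀ k ω, x k ω = mainSequence (M ω) η w₀ G (fun a => ζ a ω) k) :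
    -- The sequence is the one displayed in the theorem, and it passes through the global models.
    (∀ ω (r : ℕ) (i : Fin n) (j : ℕ), j < (M ω).steps r i →
      x (r * b + ∑ l ∈ Finset.univ.filter (· < i), (M ω).steps r l + j + 1) ω =
        x (r * b + ∑ l ∈ Finset.univ.filter (· < i), (M ω).steps r l + j) ω -
          η • G (localPoint (M ω) η w₀ G (fun a => ζ a ω) r i j) (ζ (r, i, j) ω)) ∧
    (∀ ω (r : ℕ), x (r * b) ω = globalModel (M ω) η w₀ G (fun a => ζ a ω) r) ∧
    -- The nodes of the tree carry the points of the algorithm.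
    (∀ ω (k : ℕ),
      (decayingTree (M ω) η).point w₀ G (fun a => ζ a ω) (2 * k) = x k ω ∧
      (decayingTree (M ω) η).point w₀ G (fun a => ζ a ω) ((M ω).gradNode k) =
        localPoint (M ω) η w₀ G (fun a => ζ a ω) ((M ω).sample k).1 ((M ω).sample k).2.1
          ((M ω).sample k).2.2 ∧
      (decayingTree (M ω) η).point w₀ G (fun a => ζ a ω) (2 * k + 1) =
        localPoint (M ω) η w₀ G (fun a => ζ a ω) ((M ω).sample k).1 ((M ω).sample k).2.1
          (((M ω).sample k).2.2 + 1)) ∧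
    -- The sequence is a main branch satisfying the conditions of the main theorem, `R = b - 1`.
    MainConditions μ D w₀ G ζ (fun ω => decayingTree (M ω) η)
      (fun _ k => 2 * k) (fun _ _ => η) (fun ω k => (M ω).gradNode k)
      (fun ω k => (M ω).sample k) L σ ε ((b : ℝ) - 1) η ∧
    -- The convergence rate.
    (∀ k, Integrable (fun ω => ‖gradient f (x k ω)‖ ^ 2) μ) ∧
    ∀ K : ℕ,
      8 * b * L * (f w₀ - ⨅ y, f y) / ε + 16 * σ ^ 2 * L * (f w₀ - ⨅ y, f y) / ε ^ 2 ≤ (K : ℝ) →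
      1 / (K : ℝ) * ∑ k ∈ Finset.range K, ∫ ω, ‖gradient f (x k ω)‖ ^ 2 ∂μ ≤ ε := by
  have hb : 0 < b := by
    obtain ⟨ω⟩ := nonempty_of_isProbabilityMeasure μ
    exact (M ω).pos
  have hP := isLocalSGDProcess_decayingTree (G := G) (w₀ := w₀) η hb hM hζ hlaw hindep hMζ
  have hX : ∀ k ω, (decayingTree (M ω) η).point w₀ G (fun a => ζ a ω) (2 * k) = x k ω :=
    fun k ω => (decayingTree_point_eq (M ω) η w₀ G _ k).1.trans (hx k ω).symm
  simp only [hX] at hP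
  refine ⟨fun ω r i j hj => ?_, fun ω r => ?_, fun ω k => ⟨hX k ω,
    (decayingTree_point_eq (M ω) η w₀ G _ k).2,
    decayingTree_point_two_mul_add_one_eq (M ω) η w₀ G _ k⟩, ?_, fun k => ?_, fun K hK => ?_⟩
  · rw [hx, hx]
    exact mainSequence_sample (M ω) η w₀ G _ hj
  · rw [hx]
    exact mainSequence_mul (M ω) η w₀ G _ r
  · exact mainConditions_decayingTree hG hb hL hσ hε hη
      (isLocalSGDProcess_decayingTree η hb hM hζ hlaw hindep hMζ)
  · exact (memLp_gradient hf (hP.memLp_points hf hG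
      (hη ▸ (globalStep_pos hb hL hσ hε).le) k).1).integrable_norm_pow (by norm_num)
  · have h := hP.sum_integral_sq_gradient_le hf hG hL hσ hε hbdd hη hK
    rcases K.eq_zero_or_pos with rfl | hK0
    -- For `K = 0` the average is `0`, because `1 / 0 = 0`.
    · simpa using hε.le
    · rw [one_div, inv_mul_le_iff₀ (Nat.cast_pos.2 hK0), mul_comm]
      exact h
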